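/- Let $\mathcal C$ be a symmetric tensor category over $\mathbb C$, that is, a $\mathbb C$-linear abelian rigid symmetric monoidal category with bilinear tensor product in which all objects have finite length, all spaces of morphisms are finite dimensional, and $\mathrm{End}(\mathbf 1)=\mathbb C$. Let $\mathfrak g$ be a quadratic Lie algebra in $\mathcal C$, that is, a Lie algebra in $\mathcal C$ with an invariant nondegenerate symmetric form $B:\mathfrak g\otimes\mathfrak g\to\mathbf 1$. Let $\widehat{\mathfrak g}=\mathfrak g[z,z^{-1}]\oplus\mathbf 1$ be the affine Lie algebra in $\mathrm{Ind}\,\mathcal C$, the central extension of $\mathfrak g[z,z^{-1}]$ by the cocycle $\omega|_{\mathfrak gz^m\otimes\mathfrak gz^n}=m\,\delta_{m,-n}B$, and let $\mathrm{Vir}\ltimes\widehat{\mathfrak g}$ be the semidirect product in which $L_n$ acts by $-m z^n:\mathfrak gz^m\to\mathfrak gz^{m+n}$ and trivially on the central $\mathbf 1$, and the central element $c$ of $\mathrm{Vir}$ acts trivially; here $[L_m,L_n]=(m-n)L_{m+n}+\frac{m^3-m}{12}\delta_{m,-n}c$. Let $\mathrm{Kil}:\mathfrak g\otimes\mathfrak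 g\to\mathbf 1$ be the Killing form, $\mathrm{Kil}(x,y)=\mathrm{Tr}(\mathrm{ad}\,x\circ\mathrm{ad}\,y)$. Let $k\in\mathbb C$ be non-critical, that is, the form $B_k=kB+\frac12\mathrm{Kil}$ is nondegenerate, and let $B_k^{-1}:\mathbf 1\to\mathfrak g\otimes\mathfrak g$ be its inverse. For $i,j\in\mathbb Z$ let $C_{ij}(k):\mathbf 1\to U(\widehat{\mathfrak g})$ be the product of $B_k^{-1}\cdot(z^i\otimes z^j)$ if $i\le j$, and $C_{ij}(k)=C_{ji}(k)$ if $i>j$. Let $M$ be a $\widehat{\mathfrak g}$-module in $\mathrm{Ind}\,\mathcal C$ of level $k$ (the central subobject $\mathbf 1$ of $\widehat{\mathfrak g}$ acts on $M$ by $k$) which is admissible: for every finite length $\mathcal C$-subobject $X\subset M$ there is $N\in\mathbb N$ such that for all $n\ge N$ the action map $\mathfrak gz^n\otimes X\to M$ is zero. Then the action of $\widehat{\mathfrak g}$ on $M$ extends to an action of $\mathrm{Vir}\ltimes\widehat{\mathfrak g}$ on $M$ given by the Sugawara formula $$L_n=\frac12\sum_{i+j=n}C_{ij}(k)\qquad(n\in\mathbb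 Z),$$ where for every $X\in\mathcal C$ and every morphism $X\to M$ only finitely many terms of the sum are nonzero on $X$. The central charge of this action (the scalar by which the central element $c$ acts) is $kB\circ B_k^{-1}\in\mathrm{End}(\mathbf 1)=\mathbb C$. -/

import Mathlib

open CategoryTheory CategoryTheory.Limits CategoryTheory.MonoidalCategory Opposite
open scoped DirectSum

universe v u

set_option linter.unusedSectionVars false
set_option linter.unusedSimpArgs false

noncomputable section

namespace SymTensor

/-- A symmetric (pre-Tannakian) tensor category over `ℂ`: a `ℂ`-linear abelian rigid symmetric
monoidal category with bilinear tensor product, such that objects have finite length, spaces of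
morphisms are finite dimensional, and `End(𝟙) = ℂ`. -/
class IsSymmetricTensorCategory (C : Type u) [Category.{v} C] [Abelian C] [Linear ℂ C]
    [MonoidalCategory C] [MonoidalPreadditive C] [MonoidalLinear ℂ C] [SymmetricCategory C]
    [RigidCategory C] : Prop where
  /-- Together with `artinian`: every object has finite length. -/
  noetherian : ∀ X : C, IsNoetherianObject X
  artinian : ∀ X : C, IsArtinianObject X
  finiteDimensional_hom : ∀ X Y : C, FiniteDimensional ℂ (X ⟶ Y)
  end_unit : Function.Bijective fun a : ℂ => a • 𝟙 (𝟙_ C)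

section IndObjects

variable (C : Type u) [Category.{v} C] [Abelian C] [Linear ℂ C]

/-- An object of `Ind C`, as a `ℂ`-linear presheaf `X ↦ Hom(X, M)` on `C` whose underlying presheaf
of sets is a small filtered colimit of representable presheaves. -/
structure IndObj where
  toFunctor : Cᵒᵖ ⥤ ModuleCat.{v} ℂ
  map_add' : ∀ {X Y : C} (f g : X ⟶ Y),
    toFunctor.map (f + g).op = toFunctor.map f.op + toFunctor.map g.op
  map_smul' : ∀ {X Y : C} (a : ℂ) (f : X ⟶ Y),
    toFunctor.map (a • f).op = a • toFunctor.map f.op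
  isInd : IsIndObject (toFunctor ⋙ forget (ModuleCat.{v} ℂ))

variable {C}

namespace IndObj

/-- `M.El X` is the vector space of morphisms `X ⟶ M` in `Ind C`, for `X` in `C`
("elements of `M` with values in `X`"). -/
abbrev El (M : IndObj C) (X : C) : Type v := M.toFunctor.obj (op X)

/-- Precomposition of elements of `M` with a morphism of `C`. -/
def res (M : IndObj C) {X Y : C} (f : X ⟶ Y) : M.El Y →ₗ[ℂ] M.El X := (M.toFunctor.map f.op).hom

@[simp] lemma res_id (M : IndObj C) {X : C} (x : M.El X) : M.res (𝟙 X) x = x := by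
  simp [res]

@[simp] lemma res_res (M : IndObj C) {X Y Z : C} (f : X ⟶ Y) (g : Y ⟶ Z) (x : M.El Z) :
    M.res f (M.res g x) = M.res (f ≫ g) x := by
  simp [res]

lemma add_res (M : IndObj C) {X Y : C} (f g : X ⟶ Y) (x : M.El Y) :
    M.res (f + g) x = M.res f x + M.res g x := by
  rw [res, M.map_add']; rfl

lemma smul_res (M : IndObj C) {X Y : C} (a : ℂ) (f : X ⟶ Y) (x : M.El Y) :
    M.res (a • f) x = a • M.res f x := by
  rw [res, M.map_smul']; rfl

/-- A `C`-subobject of an ind-object `M`: an element `x : X ⟶ M` which is a monomorphism. (Every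
object of a symmetric tensor category has finite length.) -/
def IsSubobject (M : IndObj C) {X : C} (x : M.El X) : Prop :=
  ∀ Z : C, Function.Injective fun f : Z ⟶ X => M.res f x

end IndObj

variable {ι : Type}

/-- The presheaf `X ↦ ⨁ i, Hom(X, Y i)`. -/
def coprodFunctor (Y : ι → C) : Cᵒᵖ ⥤ ModuleCat.{v} ℂ where
  obj X := ModuleCat.of ℂ (⨁ i, (X.unop ⟶ Y i))
  map f := ModuleCat.ofHom (DirectSum.lmap fun i => Linear.leftComp ℂ (Y i) f.unop)
  map_id X := by
    ext x i
    simp [DirectSum.lmap_apply]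
  map_comp f g := by
    ext x i
    simp [DirectSum.lmap_apply]

lemma coprodFunctor_isInd (Y : ι → C) :
    IsIndObject (coprodFunctor Y ⋙ forget (ModuleCat.{v} ℂ)) := by
  classical
  have := Abelian.hasFiniteBiproducts (C := C)
  let I := ULift.{v} (Finset ι)
  let F : I ⥤ C :=
    { obj := fun S => ⨁ fun i : S.down => Y i
      map := fun {S T} h => biproduct.desc fun i =>
        biproduct.ι (fun i : T.down => Y i) ⟨i.1, (leOfHom h) i.2⟩
      map_id := fun S => by ext; simp
      map_comp := fun f g => by ext; simp }
  have hF : ∀ {S T : I} (h : S ⟶ T) (i : ι) (hT : i ∈ T.down),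
      F.map h ≫ biproduct.π (fun i : T.down => Y i) ⟨i, hT⟩ =
        if hS : i ∈ S.down then biproduct.π (fun i : S.down => Y i) ⟨i, hS⟩ else 0 := by
    intro S T h i hT
    refine biproduct.hom_ext' _ _ fun j => ?_
    simp only [F, biproduct.ι_desc_assoc, biproduct.ι_π]
    by_cases hS : i ∈ S.down
    · rw [dif_pos hS, biproduct.ι_π]
      by_cases hij : j = ⟨i, hS⟩
      · subst hij; simp
      · rw [dif_neg hij, dif_neg]
        intro h'
        have h'' : j.1 = i := congrArg Subtype.val h'
        exact hij (Subtype.ext h'')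
    · rw [dif_neg hS, dif_neg, comp_zero]
      intro h'
      apply hS
      have h'' : j.1 = i := congrArg Subtype.val h'
      exact h'' ▸ j.2
  let c : Cocone (F ⋙ yoneda) :=
    { pt := coprodFunctor Y ⋙ forget (ModuleCat.{v} ℂ)
      ι :=
        { app := fun S =>
          { app := fun X => ↾ fun (f : X.unop ⟶ F.obj S) =>
              (DFinsupp.mk S.down fun i => f ≫ biproduct.π (fun i : S.down => Y i) i :
                ⨁ i, (X.unop ⟶ Y i))
            naturality := by
              intro X X' f
              ext g
              refine DFinsupp.ext fun i => ?_
              change (DFinsupp.mk S.down (fun i => (f.unop ≫ g) ≫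
                    biproduct.π (fun i : S.down => Y i) i) : ⨁ i, (X'.unop ⟶ Y i)) i =
                f.unop ≫ (DFinsupp.mk S.down (fun i => g ≫
                    biproduct.π (fun i : S.down => Y i) i) : ⨁ i, (X.unop ⟶ Y i)) i
              rw [DFinsupp.mk_apply, DFinsupp.mk_apply]
              split_ifs
              · exact Category.assoc _ _ _
              · simp }
          naturality := by
            intro S T h
            ext X g
            refine DFinsupp.ext fun i => ?_
            change (DFinsupp.mk T.down (fun i => (g ≫ F.map h) ≫
                  biproduct.π (fun i : T.down => Y i) i) : ⨁ i, (X.unop ⟶ Y i)) i =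
                (DFinsupp.mk S.down (fun i => g ≫
                  biproduct.π (fun i : S.down => Y i) i) : ⨁ i, (X.unop ⟶ Y i)) i
            rw [DFinsupp.mk_apply, DFinsupp.mk_apply]
            by_cases hT : i ∈ T.down
            · rw [dif_pos hT]
              refine (Category.assoc _ _ _).trans ?_
              rw [hF h i hT]
              split_ifs
              · rfl
              · exact comp_zero
            · rw [dif_neg hT, dif_neg (fun hS => hT ((leOfHom h) hS))] } }
  have hc : IsColimit c := evaluationJointlyReflectsColimits c fun X => by
    refine Types.FilteredColimit.isColimitOf' _ _ ?_ ?_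
    · intro (x : ⨁ i, (X.unop ⟶ Y i))
      refine ⟨⟨x.support⟩, (biproduct.lift fun i : x.support => x i : X.unop ⟶ ⨁ fun i : x.support => Y i), ?_⟩
      refine DFinsupp.ext fun i => ?_
      change x i = (DFinsupp.mk x.support (fun i =>
          (biproduct.lift fun i : x.support => x i : X.unop ⟶ ⨁ fun i : x.support => Y i) ≫
            biproduct.π (fun i : x.support => Y i) i) : ⨁ i, (X.unop ⟶ Y i)) i
      rw [DFinsupp.mk_apply]
      by_cases hi : i ∈ x.support
      · rw [dif_pos hi]
        exact (biproduct.lift_π (f := fun i : x.support => Y i) (fun i => x i) ⟨i, hi⟩).symm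
      · rw [dif_neg hi]
        exact DFinsupp.notMem_support_iff.1 hi
    · intro S (f : X.unop ⟶ F.obj S) (g : X.unop ⟶ F.obj S) h
      refine ⟨S, 𝟙 _, ?_⟩
      have : f = g := by
        refine biproduct.hom_ext _ _ fun i => ?_
        have h' : (DFinsupp.mk S.down (fun i => f ≫
              biproduct.π (fun i : S.down => Y i) i) : ⨁ i, (X.unop ⟶ Y i)) i =
          (DFinsupp.mk S.down (fun i => g ≫
              biproduct.π (fun i : S.down => Y i) i) : ⨁ i, (X.unop ⟶ Y i)) i :=
          congrArg (fun x : ⨁ i, (X.unop ⟶ Y i) => x i) h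
        rw [DFinsupp.mk_apply, DFinsupp.mk_apply, dif_pos i.2, dif_pos i.2] at h'
        exact h'
      rw [this]
  exact IsIndObject.mk (IndObjectPresentation.ofCocone c hc)

/-- The coproduct `∐ i, Y i` in `Ind C` of a family of objects of `C`. -/
def coprod (Y : ι → C) : IndObj C where
  toFunctor := coprodFunctor Y
  map_add' f g := by
    ext x
    exact DFinsupp.ext fun i => Preadditive.add_comp _ _ _ f g _
  map_smul' a f := by
    ext x
    exact DFinsupp.ext fun i => Linear.smul_comp _ _ _ a f _
  isInd := coprodFunctor_isInd Y

open Classical in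
/-- The element `X ⟶ Y i ⟶ ∐ i, Y i` given by a morphism `X ⟶ Y i`. -/
def coprodι (Y : ι → C) (i : ι) {X : C} : (X ⟶ Y i) →ₗ[ℂ] (coprod Y).El X :=
  DirectSum.lof ℂ ι (fun i => (X ⟶ Y i)) i

@[simp] lemma res_coprodι (Y : ι → C) (i : ι) {X X' : C} (f : X' ⟶ X) (g : X ⟶ Y i) :
    (coprod Y).res f (coprodι Y i g) = coprodι Y i (f ≫ g) := by
  classical
  exact DirectSum.lmap_lof (R := ℂ) (fun i => Linear.leftComp ℂ (Y i) f) i g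

lemma coprod_induction (Y : ι → C) {X : C} {p : (coprod Y).El X → Prop} (x : (coprod Y).El X)
    (zero : p 0) (add : ∀ x y, p x → p y → p (x + y))
    (of : ∀ (i : ι) (f : X ⟶ Y i), p (coprodι Y i f)) : p x := by
  classical
  exact DirectSum.induction_on x zero of add

open Classical in
/-- A linear map out of `(∐ i, Y i)(X) = ⨁ i, Hom(X, Y i)`. -/
def coprodDesc (Y : ι → C) {X : C} {V : Type*} [AddCommGroup V] [Module ℂ V]
    (φ : ∀ i, (X ⟶ Y i) →ₗ[ℂ] V) : (coprod Y).El X →ₗ[ℂ] V :=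
  DirectSum.toModule ℂ ι V φ

@[simp] lemma coprodDesc_ι (Y : ι → C) {X : C} {V : Type*} [AddCommGroup V] [Module ℂ V]
    (φ : ∀ i, (X ⟶ Y i) →ₗ[ℂ] V) (i : ι) (f : X ⟶ Y i) :
    coprodDesc Y φ (coprodι Y i f) = φ i f := by
  classical
  exact DirectSum.toModule_lof (M := fun i => (X ⟶ Y i)) ℂ i f

lemma coprod_hom_ext (Y : ι → C) {X : C} {V : Type*} [AddCommGroup V] [Module ℂ V]
    {φ ψ : (coprod Y).El X →ₗ[ℂ] V}
    (h : ∀ (i : ι) (f : X ⟶ Y i), φ (coprodι Y i f) = ψ (coprodι Y i f)) : φ = ψ := by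
  ext x
  induction x using coprod_induction with
  | zero => simp
  | add x y hx hy => simp [hx, hy]
  | of i f => exact h i f

end IndObjects

section Bilinear

variable {C : Type u} [Category.{v} C] [Abelian C] [Linear ℂ C] [MonoidalCategory C]

/-- A morphism `M ⊗ N ⟶ P` in `Ind C`. The tensor product of `Ind C` is the extension of the one
of `C` commuting with filtered colimits, that is, the Day convolution of presheaves; so a morphism
out of it is a family of bilinear maps `Hom(X, M) × Hom(Y, N) → Hom(X ⊗ Y, P)`, natural in the
objects `X` and `Y` of `C`. -/
structure Bilin (M N P : IndObj C) where
  app : ∀ {X Y : C}, M.El X →ₗ[ℂ] N.El Y →ₗ[ℂ] P.El (X ⊗ Y)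
  naturality : ∀ {X X' Y Y' : C} (f : X' ⟶ X) (g : Y' ⟶ Y) (m : M.El X) (n : N.El Y),
    app (M.res f m) (N.res g n) = P.res (f ⊗ₘ g) (app m n)

namespace Bilin

variable {M N P : IndObj C}

lemma res_left (b : Bilin M N P) {X X' Y : C} (f : X' ⟶ X) (m : M.El X) (n : N.El Y) :
    b.app (M.res f m) n = P.res (f ▷ Y) (b.app m n) := by
  simpa using b.naturality f (𝟙 Y) m n

lemma res_right (b : Bilin M N P) {X Y Y' : C} (g : Y' ⟶ Y) (m : M.El X) (n : N.El Y) :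
    b.app m (N.res g n) = P.res (X ◁ g) (b.app m n) := by
  simpa using b.naturality (𝟙 X) g m n

variable [MonoidalPreadditive C] [MonoidalLinear ℂ C]

/-- The morphism `(∐ i, Y i) ⊗ (∐ j, Y' j) ⟶ P` with components `p i j : Y i ⊗ Y' j ⟶ P`. -/
def ofComponents {ι ι' : Type} (Y : ι → C) (Y' : ι' → C) (P : IndObj C)
    (p : ∀ i j, P.El (Y i ⊗ Y' j)) : Bilin (coprod Y) (coprod Y') P where
  app {X X'} := coprodDesc Y fun i =>
    { toFun := fun f => coprodDesc Y' fun j =>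
        { toFun := fun g => P.res (f ⊗ₘ g) (p i j)
          map_add' := fun g g' => by
            rw [MonoidalPreadditive.tensor_add, IndObj.add_res]
          map_smul' := fun a g => by
            simp [MonoidalCategory.tensorHom_def, IndObj.smul_res] }
      map_add' := fun f f' => coprod_hom_ext _ fun j g => by
        simp [MonoidalPreadditive.add_tensor, IndObj.add_res]
      map_smul' := fun a f => coprod_hom_ext _ fun j g => by
        simp [MonoidalCategory.tensorHom_def, IndObj.smul_res] }
  naturality f g m n := by
    induction m using coprod_induction with
    | zero => simp
    | add x y hx hy => simp [hx, hy]
    | of i f' =>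
      induction n using coprod_induction with
      | zero => simp
      | add x y hx hy => simp only [map_add, hx, hy]
      | of j g' => simp [MonoidalCategory.tensorHom_comp_tensorHom]

@[simp] lemma ofComponents_app {ι ι' : Type} (Y : ι → C) (Y' : ι' → C) (P : IndObj C)
    (p : ∀ i j, P.El (Y i ⊗ Y' j)) {X X' : C} (i : ι) (j : ι') (f : X ⟶ Y i) (g : X' ⟶ Y' j) :
    (ofComponents Y Y' P p).app (coprodι Y i f) (coprodι Y' j g) = P.res (f ⊗ₘ g) (p i j) := by
  simp [ofComponents]

end Bilin

end Bilinear

section LieAlgebras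

variable {C : Type u} [Category.{v} C] [MonoidalCategory C] [SymmetricCategory C]

/-- The permutation `x ⊗ y ⊗ z ↦ y ⊗ x ⊗ z`. -/
def swapLeft (X Y Z : C) : X ⊗ (Y ⊗ Z) ⟶ Y ⊗ (X ⊗ Z) :=
  (α_ X Y Z).inv ≫ (β_ X Y).hom ▷ Z ≫ (α_ Y X Z).hom

lemma swapLeft_naturality {X X' Y Y' Z Z' : C} (f : X ⟶ X') (g : Y ⟶ Y') (h : Z ⟶ Z') :
    (f ⊗ₘ (g ⊗ₘ h)) ≫ swapLeft X' Y' Z' = swapLeft X Y Z ≫ (g ⊗ₘ (f ⊗ₘ h)) := by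
  simp only [swapLeft, Category.assoc, associator_inv_naturality_assoc, ← associator_naturality]
  simp only [← tensorHom_id, tensorHom_comp_tensorHom_assoc, BraidedCategory.braiding_naturality,
    Category.comp_id, Category.id_comp]

lemma swapLeft_unit₁ (X Y : C) : swapLeft (𝟙_ C) X Y ≫ X ◁ (λ_ Y).hom = (λ_ (X ⊗ Y)).hom := by
  simp [swapLeft, braiding_tensorUnit_left]

lemma swapLeft_unit₂ (X Y : C) : swapLeft X (𝟙_ C) Y ≫ (λ_ (X ⊗ Y)).hom = X ◁ (λ_ Y).hom := by
  simp [swapLeft, braiding_tensorUnit_right]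

lemma swapLeft_unit₃ (X Y : C) :
    swapLeft X Y (𝟙_ C) ≫ Y ◁ (ρ_ X).hom = X ◁ (ρ_ Y).hom ≫ (β_ X Y).hom := by
  simp [swapLeft]

lemma assoc_unit₁ (X Y : C) :
    (α_ (𝟙_ C) X Y).inv ≫ (λ_ X).hom ▷ Y = (λ_ (X ⊗ Y)).hom := by
  simp

lemma assoc_unit₂ (X Y : C) :
    (α_ X (𝟙_ C) Y).inv ≫ (ρ_ X).hom ▷ Y = X ◁ (λ_ Y).hom := by
  simp

lemma assoc_unit₃ (X Y : C) :
    (α_ X Y (𝟙_ C)).inv ≫ (ρ_ (X ⊗ Y)).hom = X ◁ (ρ_ Y).hom := by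
  simp

variable [Abelian C] [Linear ℂ C]

variable (C) in
/-- A Lie algebra in `Ind C`. -/
structure LieAlg where
  obj : IndObj C
  bracket : Bilin obj obj obj
  skew : ∀ {X Y : C} (a : obj.El X) (b : obj.El Y),
    bracket.app a b = - obj.res (β_ X Y).hom (bracket.app b a)
  jacobi : ∀ {X Y Z : C} (a : obj.El X) (b : obj.El Y) (c : obj.El Z),
    bracket.app a (bracket.app b c) =
      obj.res (α_ X Y Z).inv (bracket.app (bracket.app a b) c) +
        obj.res (swapLeft X Y Z) (bracket.app b (bracket.app a c))

/-- A module in `Ind C` over a Lie algebra `L` in `Ind C`: an object `M` with an action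
`L ⊗ M ⟶ M` such that `[a, b] m = a (b m) - b (a m)`. -/
structure LieMod (L : LieAlg C) (M : IndObj C) where
  act : Bilin L.obj M M
  lie : ∀ {X Y Z : C} (a : L.obj.El X) (b : L.obj.El Y) (m : M.El Z),
    M.res (α_ X Y Z).inv (act.app (L.bracket.app a b) m) =
      act.app a (act.app b m) - M.res (swapLeft X Y Z) (act.app b (act.app a m))

/-- The Jacobi identity for three elements. -/
def Jacobi {M : IndObj C} (b : Bilin M M M) {X Y Z : C} (x : M.El X) (y : M.El Y) (z : M.El Z) :
    Prop :=
  b.app x (b.app y z) =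
    M.res (α_ X Y Z).inv (b.app (b.app x y) z) + M.res (swapLeft X Y Z) (b.app y (b.app x z))

/-- `x` is annihilated by the bilinear operation `b`. -/
def Central {M : IndObj C} (b : Bilin M M M) {X : C} (x : M.El X) : Prop :=
  (∀ {Y : C} (y : M.El Y), b.app x y = 0) ∧ ∀ {Y : C} (y : M.El Y), b.app y x = 0

lemma jacobi_of_central {M : IndObj C} (b : Bilin M M M) {X Y Z : C} (x : M.El X) (y : M.El Y)
    (z : M.El Z) (h : Central b x ∨ Central b y ∨ Central b z) : Jacobi b x y z := by
  unfold Jacobi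
  rcases h with h | h | h <;> simp [h.1, h.2]

/-- The Lie algebra structure on `∐ i, Y i` with bracket components `p i j`. -/
def LieAlg.ofComponents [MonoidalPreadditive C] [MonoidalLinear ℂ C] {ι : Type} (Y : ι → C)
    (p : ∀ i j, (coprod Y).El (Y i ⊗ Y j))
    (skew : ∀ i j, p i j = - (coprod Y).res (β_ (Y i) (Y j)).hom (p j i))
    (jacobi : ∀ i j k, Jacobi (Bilin.ofComponents Y Y _ p)
      (coprodι Y i (𝟙 (Y i))) (coprodι Y j (𝟙 (Y j))) (coprodι Y k (𝟙 (Y k)))) :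
    LieAlg C where
  obj := coprod Y
  bracket := Bilin.ofComponents Y Y _ p
  skew a b := by
    induction a using coprod_induction with
    | zero => simp
    | add x y hx hy => simp only [map_add, LinearMap.add_apply, hx, hy, neg_add]
    | of i f =>
      induction b using coprod_induction with
      | zero => simp
      | add x y hx hy => simp only [map_add, LinearMap.add_apply, hx, hy, neg_add]
      | of j g =>
        rw [Bilin.ofComponents_app, Bilin.ofComponents_app, skew i j]
        simp
  jacobi {X X' X''} a b c := by
    induction a using coprod_induction with
    | zero => simp
    | add x y hx hy =>
      simp only [map_add, LinearMap.add_apply, hx, hy]; abel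
    | of i f =>
      induction b using coprod_induction with
      | zero => simp
      | add x y hx hy => simp only [map_add, LinearMap.add_apply, hx, hy]; abel
      | of j g =>
        induction c using coprod_induction with
        | zero => simp
        | add x y hx hy => simp only [map_add, hx, hy]; abel
        | of k h =>
          have e : ∀ (l : ι) {T : C} (t : T ⟶ Y l),
              coprodι Y l t = (coprod Y).res t (coprodι Y l (𝟙 (Y l))) := by
            intro l T t; simp
          have J := congrArg ((coprod Y).res (f ⊗ₘ (g ⊗ₘ h))) (jacobi i j k)
          rw [e i f, e j g, e k h]
          simp only [Bilin.naturality, map_add, IndObj.res_res] at J ⊢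
          rw [J, associator_inv_naturality, swapLeft_naturality]

end LieAlgebras

section Summands

variable {C : Type u} [Category.{v} C] [Abelian C] [Linear ℂ C] [MonoidalCategory C]

/-- Index set for the summands `g zⁿ` and `𝟙` of the affine Lie algebra. -/
inductive AffIdx
  | z (n : ℤ)
  | K

/-- The summands of the affine Lie algebra. -/
def affObj (g : C) : AffIdx → C
  | .z _ => g
  | .K => 𝟙_ C

/-- Index set for the summands of `Vir ⋉ ĝ`: the lines spanned by the elements `Lₙ` and the central
element `c` of `Vir`, and the summands `g zⁿ` and `𝟙` of the affine Lie algebra. -/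
inductive VirAffIdx
  | L (n : ℤ)
  | c
  | z (n : ℤ)
  | K

/-- The summands of `Vir ⋉ ĝ`. -/
def virAffObj (g : C) : VirAffIdx → C
  | .L _ => 𝟙_ C
  | .c => 𝟙_ C
  | .z _ => g
  | .K => 𝟙_ C

/-- The scalar `m δ_{m,-n}`. -/
def affCocycle (m n : ℤ) : ℂ := if m + n = 0 then (m : ℂ) else 0

/-- The scalar `(m³ - m)/12 δ_{m,-n}`. -/
def virCocycle (m n : ℤ) : ℂ := if m + n = 0 then ((m : ℂ) ^ 3 - m) / 12 else 0

variable (g : C)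

/-- `x ↦ x zⁿ`. -/
def affZ (n : ℤ) {X : C} : (X ⟶ g) →ₗ[ℂ] (coprod (affObj g)).El X := coprodι (affObj g) (.z n)

/-- `a ↦ a K`. -/
def affK {X : C} : (X ⟶ 𝟙_ C) →ₗ[ℂ] (coprod (affObj g)).El X := coprodι (affObj g) .K

/-- `a ↦ a Lₙ`. -/
def virAffL (n : ℤ) {X : C} : (X ⟶ 𝟙_ C) →ₗ[ℂ] (coprod (virAffObj g)).El X :=
  coprodι (virAffObj g) (.L n)

/-- `a ↦ a c`. -/
def virAffC {X : C} : (X ⟶ 𝟙_ C) →ₗ[ℂ] (coprod (virAffObj g)).El X := coprodι (virAffObj g) .c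

/-- `x ↦ x zⁿ`. -/
def virAffZ (n : ℤ) {X : C} : (X ⟶ g) →ₗ[ℂ] (coprod (virAffObj g)).El X :=
  coprodι (virAffObj g) (.z n)

/-- `a ↦ a K`. -/
def virAffK {X : C} : (X ⟶ 𝟙_ C) →ₗ[ℂ] (coprod (virAffObj g)).El X := coprodι (virAffObj g) .K

@[simp] lemma res_affZ (n : ℤ) {X Y : C} (f : X ⟶ Y) (x : Y ⟶ g) :
    (coprod (affObj g)).res f (affZ g n x) = affZ g n (f ≫ x) := res_coprodι _ _ _ _

@[simp] lemma res_affK {X Y : C} (f : X ⟶ Y) (x : Y ⟶ 𝟙_ C) :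
    (coprod (affObj g)).res f (affK g x) = affK g (f ≫ x) := res_coprodι _ _ _ _

@[simp] lemma res_virAffL (n : ℤ) {X Y : C} (f : X ⟶ Y) (x : Y ⟶ 𝟙_ C) :
    (coprod (virAffObj g)).res f (virAffL g n x) = virAffL g n (f ≫ x) := res_coprodι _ _ _ _

@[simp] lemma res_virAffC {X Y : C} (f : X ⟶ Y) (x : Y ⟶ 𝟙_ C) :
    (coprod (virAffObj g)).res f (virAffC g x) = virAffC g (f ≫ x) := res_coprodι _ _ _ _

@[simp] lemma res_virAffZ (n : ℤ) {X Y : C} (f : X ⟶ Y) (x : Y ⟶ g) :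
    (coprod (virAffObj g)).res f (virAffZ g n x) = virAffZ g n (f ≫ x) := res_coprodι _ _ _ _

@[simp] lemma res_virAffK {X Y : C} (f : X ⟶ Y) (x : Y ⟶ 𝟙_ C) :
    (coprod (virAffObj g)).res f (virAffK g x) = virAffK g (f ≫ x) := res_coprodι _ _ _ _

end Summands

section LieObjects

variable {C : Type u} [Category.{v} C] [Abelian C] [Linear ℂ C] [MonoidalCategory C]
  [SymmetricCategory C]

/-- A Lie algebra in the symmetric tensor category `C`, with underlying object `g`. -/
class LieObj (g : C) where
  bracket : g ⊗ g ⟶ g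
  skew : (β_ g g).hom ≫ bracket = -bracket
  jacobi : g ◁ bracket ≫ bracket =
    (α_ g g g).inv ≫ bracket ▷ g ≫ bracket + swapLeft g g g ≫ g ◁ bracket ≫ bracket

variable [RigidCategory C]

/-- The morphism `g ⟶ g*`, `x ↦ b(x, -)`, attached to a form `b` on `g`. -/
def toDual {g : C} (b : g ⊗ g ⟶ 𝟙_ C) : g ⟶ gᘁ :=
  (ρ_ g).inv ≫ g ◁ η_ g (gᘁ : C) ≫ (α_ g g (gᘁ : C)).inv ≫ b ▷ (gᘁ : C) ≫ (λ_ (gᘁ : C)).hom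

/-- A bilinear form is nondegenerate if it induces an isomorphism `g ≅ g*`. -/
def Nondegenerate {g : C} (b : g ⊗ g ⟶ 𝟙_ C) : Prop := IsIso (toDual b)

/-- The inverse `b⁻¹ : 𝟙 ⟶ g ⊗ g` of a nondegenerate form `b`, that is,
`∑ eᵢ ⊗ eⁱ` for bases which are dual with respect to `b`. -/
def copairing {g : C} (b : g ⊗ g ⟶ 𝟙_ C) (h : Nondegenerate b) : 𝟙_ C ⟶ g ⊗ g :=
  haveI : IsIso (toDual b) := h
  η_ g (gᘁ : C) ≫ g ◁ inv (toDual b)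

/-- The Killing form `(x, y) ↦ Tr (ad x ∘ ad y)`. -/
def killing (g : C) [LieObj g] : g ⊗ g ⟶ 𝟙_ C :=
  (ρ_ (g ⊗ g)).inv ≫ (g ⊗ g) ◁ η_ g (gᘁ : C) ≫ (α_ g g (g ⊗ (gᘁ : C))).hom ≫
    g ◁ ((α_ g g (gᘁ : C)).inv ≫ LieObj.bracket ▷ (gᘁ : C)) ≫
    (α_ g g (gᘁ : C)).inv ≫ LieObj.bracket ▷ (gᘁ : C) ≫ (β_ g (gᘁ : C)).hom ≫ ε_ g (gᘁ : C)

/-- The structure of a quadratic Lie algebra: an invariant nondegenerate symmetric form. -/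
class Quadratic (g : C) [LieObj g] where
  form : g ⊗ g ⟶ 𝟙_ C
  symm : (β_ g g).hom ≫ form = form
  invariant : LieObj.bracket ▷ g ≫ form = (α_ g g g).hom ≫ g ◁ LieObj.bracket ≫ form
  nondegenerate : Nondegenerate form

/-- The form `B_k = k B + (1/2) Kil`. -/
def levelForm (g : C) [LieObj g] [Quadratic g] (k : ℂ) : g ⊗ g ⟶ 𝟙_ C :=
  k • Quadratic.form + (1 / 2 : ℂ) • killing g

/-- Non-critical levels. -/
def IsNonCritical (g : C) [LieObj g] [Quadratic g] (k : ℂ) : Prop :=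
  Nondegenerate (levelForm g k)

variable [MonoidalPreadditive C] [MonoidalLinear ℂ C] (g : C) [LieObj g] [Quadratic g]

/-- The components of the bracket of the affine Lie algebra:
`[x zᵐ, y zⁿ] = [x, y] zᵐ⁺ⁿ + m δ_{m,-n} B(x, y) K`, with `K` central. -/
def affBracket : ∀ i j : AffIdx, (coprod (affObj g)).El (affObj g i ⊗ affObj g j)
  | .z m, .z n =>
      affZ g (m + n) (LieObj.bracket (g := g)) + affK g (affCocycle m n • Quadratic.form (g := g))
  | .z _, .K => 0
  | .K, .z _ => 0
  | .K, .K => 0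

/-- The components of the bracket of `Vir ⋉ ĝ`:
`[Lₘ, Lₙ] = (m - n) Lₘ₊ₙ + (m³ - m)/12 δ_{m,-n} c`, `[Lₙ, x zᵐ] = - m x zᵐ⁺ⁿ`,
`[x zᵐ, y zⁿ] = [x, y] zᵐ⁺ⁿ + m δ_{m,-n} B(x, y) K`, with `c` and `K` central. -/
def virAffBracket : ∀ i j : VirAffIdx,
    (coprod (virAffObj g)).El (virAffObj g i ⊗ virAffObj g j)
  | .L m, .L n =>
      virAffL g (m + n) (((m : ℂ) - n) • (λ_ (𝟙_ C)).hom) +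
        virAffC g (virCocycle m n • (λ_ (𝟙_ C)).hom)
  | .L n, .z m => virAffZ g (m + n) ((-m : ℂ) • (λ_ g).hom)
  | .z m, .L n => virAffZ g (m + n) ((m : ℂ) • (ρ_ g).hom)
  | .z m, .z n =>
      virAffZ g (m + n) (LieObj.bracket (g := g)) +
        virAffK g (affCocycle m n • Quadratic.form (g := g))
  | .L _, .c => 0
  | .L _, .K => 0
  | .z _, .c => 0
  | .z _, .K => 0
  | .c, _ => 0
  | .K, _ => 0

lemma affCocycle_swap (m n : ℤ) : affCocycle n m = - affCocycle m n := by
  unfold affCocycle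
  rw [add_comm n m]
  split_ifs with h
  · rw [eq_neg_of_add_eq_zero_right h]; simp
  · simp

lemma virCocycle_swap (m n : ℤ) : virCocycle n m = - virCocycle m n := by
  unfold virCocycle
  rw [add_comm n m]
  split_ifs with h
  · rw [eq_neg_of_add_eq_zero_right h]; push_cast; ring
  · simp

lemma affBracket_skew (i j : AffIdx) : affBracket g i j =
    - (coprod (affObj g)).res (β_ (affObj g i) (affObj g j)).hom (affBracket g j i) := by
  have zz (m n : ℤ) : affZ g (m + n) (LieObj.bracket (g := g)) +
      affK g (affCocycle m n • Quadratic.form (g := g)) =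
      - (coprod (affObj g)).res (β_ g g).hom (affZ g (n + m) (LieObj.bracket (g := g)) +
        affK g (affCocycle n m • Quadratic.form (g := g))) := by
    rw [map_add, res_affZ, res_affK,
      Linear.comp_smul, Quadratic.symm, LieObj.skew, affCocycle_swap m n, add_comm n m]
    simp only [map_smul, map_neg]
    module
  cases i <;> cases j <;> simp only [affBracket, map_zero, neg_zero]
  exact zz _ _

lemma virAffBracket_skew (i j : VirAffIdx) : virAffBracket g i j =
    - (coprod (virAffObj g)).res (β_ (virAffObj g i) (virAffObj g j)).hom
      (virAffBracket g j i) := by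
  have hβ : (β_ (𝟙_ C) (𝟙_ C)).hom ≫ (λ_ (𝟙_ C)).hom = (λ_ (𝟙_ C)).hom := by
    rw [braiding_leftUnitor, unitors_equal]
  have LL (m n : ℤ) : virAffL g (m + n) (((m : ℂ) - n) • (λ_ (𝟙_ C)).hom) +
        virAffC g (virCocycle m n • (λ_ (𝟙_ C)).hom) =
      - (coprod (virAffObj g)).res (β_ (𝟙_ C) (𝟙_ C)).hom
        (virAffL g (n + m) (((n : ℂ) - m) • (λ_ (𝟙_ C)).hom) +
        virAffC g (virCocycle n m • (λ_ (𝟙_ C)).hom)) := by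
    rw [map_add, res_virAffL, res_virAffC, virCocycle_swap m n, add_comm n m]
    simp only [Linear.comp_smul, hβ, map_smul]
    module
  have Lz (m n : ℤ) : virAffZ g (n + m) ((-n : ℂ) • (λ_ g).hom) =
      - (coprod (virAffObj g)).res (β_ (𝟙_ C) g).hom
        (virAffZ g (n + m) ((n : ℂ) • (ρ_ g).hom)) := by
    rw [res_virAffZ]
    simp only [Linear.comp_smul, braiding_rightUnitor, map_smul]
    module
  have zL (m n : ℤ) : virAffZ g (m + n) ((m : ℂ) • (ρ_ g).hom) =
      - (coprod (virAffObj g)).res (β_ g (𝟙_ C)).hom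
        (virAffZ g (m + n) ((-m : ℂ) • (λ_ g).hom)) := by
    rw [res_virAffZ]
    simp only [Linear.comp_smul, braiding_leftUnitor, map_smul]
    module
  have zz (m n : ℤ) : virAffZ g (m + n) (LieObj.bracket (g := g)) +
      virAffK g (affCocycle m n • Quadratic.form (g := g)) =
      - (coprod (virAffObj g)).res (β_ g g).hom (virAffZ g (n + m) (LieObj.bracket (g := g)) +
        virAffK g (affCocycle n m • Quadratic.form (g := g))) := by
    rw [map_add, res_virAffZ, res_virAffK,
      Linear.comp_smul, Quadratic.symm, LieObj.skew, affCocycle_swap m n, add_comm n m]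
    simp only [map_smul, map_neg]
    module
  cases i <;> cases j <;> simp only [virAffBracket, map_zero, neg_zero]
  · exact LL _ _
  · exact Lz _ _
  · exact zL _ _
  · exact zz _ _

lemma form_swap : swapLeft g g g ≫ g ◁ LieObj.bracket ≫ Quadratic.form (g := g) =
    - g ◁ LieObj.bracket ≫ Quadratic.form (g := g) := by
  have h : g ◁ LieObj.bracket ≫ Quadratic.form (g := g) =
      (α_ g g g).inv ≫ LieObj.bracket ▷ g ≫ Quadratic.form := by
    rw [Quadratic.invariant]; simp
  have h' : (β_ g g).hom ▷ g ≫ LieObj.bracket ▷ g = - LieObj.bracket ▷ g := by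
    rw [← comp_whiskerRight, LieObj.skew]
    exact (tensorRight g).map_neg
  rw [h, swapLeft]
  simp only [Category.assoc, Iso.hom_inv_id_assoc, reassoc_of% h']
  simp

/-- The bracket of the affine Lie algebra. -/
def affBilin : Bilin (coprod (affObj g)) (coprod (affObj g)) (coprod (affObj g)) :=
  Bilin.ofComponents _ _ _ (affBracket g)

lemma affBilin_zz (m n : ℤ) {X Y : C} (x : X ⟶ g) (y : Y ⟶ g) :
    (affBilin g).app (affZ g m x) (affZ g n y) =
      affZ g (m + n) ((x ⊗ₘ y) ≫ LieObj.bracket) +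
        affK g (affCocycle m n • (x ⊗ₘ y) ≫ Quadratic.form) := by
  have h : (affBilin g).app (affZ g m x) (affZ g n y) = (coprod (affObj g)).res (x ⊗ₘ y)
      (affZ g (m + n) (LieObj.bracket (g := g)) +
        affK g (affCocycle m n • Quadratic.form (g := g))) := Bilin.ofComponents_app ..
  rw [h, map_add, res_affZ, res_affK, Linear.comp_smul]

lemma affBilin_central {X : C} (x : X ⟶ 𝟙_ C) : Central (affBilin g) (affK g x) := by
  constructor <;> intro Y y <;> induction y using coprod_induction with
    | zero => simp
    | add x y hx hy => simp [hx, hy]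
    | of i f => exact (Bilin.ofComponents_app ..).trans (by cases i <;> exact map_zero _)

lemma affCocycle_jacobi (l m n : ℤ) :
    affCocycle l (m + n) = affCocycle (l + m) n - affCocycle m (l + n) := by
  unfold affCocycle
  rw [← add_assoc, show m + (l + n) = l + m + n by ring]
  split_ifs
  · push_cast; ring
  · simp

lemma affBilin_jacobi (i j k : AffIdx) : Jacobi (affBilin g)
    (coprodι (affObj g) i (𝟙 _)) (coprodι (affObj g) j (𝟙 _)) (coprodι (affObj g) k (𝟙 _)) := by
  have zzz (l m n : ℤ) :
      Jacobi (affBilin g) (affZ g l (𝟙 g)) (affZ g m (𝟙 g)) (affZ g n (𝟙 g)) := by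
    unfold Jacobi
    simp only [affBilin_zz, (affBilin_central g _).1, (affBilin_central g _).2, map_add, LinearMap.add_apply, add_zero,
      res_affZ, res_affK, id_tensorHom, tensorHom_id, id_whiskerRight, Category.id_comp]
    rw [affCocycle_jacobi l m n]
    simp only [Linear.comp_smul, form_swap, Quadratic.invariant, Iso.inv_hom_id_assoc, map_smul,
      map_neg]
    rw [← add_assoc l m n, show m + (l + n) = l + m + n by ring,
      congrArg (affZ g (l + m + n)) (LieObj.jacobi (g := g)), map_add]
    module
  have hK : Central (affBilin g) (coprodι (affObj g) .K (𝟙 (affObj g .K))) :=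
    affBilin_central g _
  cases i with
  | K => exact jacobi_of_central _ _ _ _ (.inl hK)
  | z l =>
    cases j with
    | K => exact jacobi_of_central _ _ _ _ (.inr (.inl hK))
    | z m =>
      cases k with
      | K => exact jacobi_of_central _ _ _ _ (.inr (.inr hK))
      | z n => exact zzz l m n

/-- The bracket of `Vir ⋉ ĝ`. -/
def virAffBilin :
    Bilin (coprod (virAffObj g)) (coprod (virAffObj g)) (coprod (virAffObj g)) :=
  Bilin.ofComponents _ _ _ (virAffBracket g)

lemma virAffBilin_LL (m n : ℤ) {X Y : C} (x : X ⟶ 𝟙_ C) (y : Y ⟶ 𝟙_ C) :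
    (virAffBilin g).app (virAffL g m x) (virAffL g n y) =
      virAffL g (m + n) (((m : ℂ) - n) • (x ⊗ₘ y) ≫ (λ_ (𝟙_ C)).hom) +
        virAffC g (virCocycle m n • (x ⊗ₘ y) ≫ (λ_ (𝟙_ C)).hom) := by
  have h : (virAffBilin g).app (virAffL g m x) (virAffL g n y) =
      (coprod (virAffObj g)).res (x ⊗ₘ y)
        (virAffL g (m + n) (((m : ℂ) - n) • (λ_ (𝟙_ C)).hom) +
          virAffC g (virCocycle m n • (λ_ (𝟙_ C)).hom)) := Bilin.ofComponents_app ..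
  rw [h, map_add, res_virAffL, res_virAffC, Linear.comp_smul, Linear.comp_smul]

lemma virAffBilin_Lz (n m : ℤ) {X Y : C} (x : X ⟶ 𝟙_ C) (y : Y ⟶ g) :
    (virAffBilin g).app (virAffL g n x) (virAffZ g m y) =
      virAffZ g (m + n) ((-m : ℂ) • (x ⊗ₘ y) ≫ (λ_ g).hom) := by
  have h : (virAffBilin g).app (virAffL g n x) (virAffZ g m y) =
      (coprod (virAffObj g)).res (x ⊗ₘ y)
        (virAffZ g (m + n) ((-m : ℂ) • (λ_ g).hom)) := Bilin.ofComponents_app ..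
  rw [h, res_virAffZ, Linear.comp_smul]

lemma virAffBilin_zL (m n : ℤ) {X Y : C} (x : X ⟶ g) (y : Y ⟶ 𝟙_ C) :
    (virAffBilin g).app (virAffZ g m x) (virAffL g n y) =
      virAffZ g (m + n) ((m : ℂ) • (x ⊗ₘ y) ≫ (ρ_ g).hom) := by
  have h : (virAffBilin g).app (virAffZ g m x) (virAffL g n y) =
      (coprod (virAffObj g)).res (x ⊗ₘ y)
        (virAffZ g (m + n) ((m : ℂ) • (ρ_ g).hom)) := Bilin.ofComponents_app ..
  rw [h, res_virAffZ, Linear.comp_smul]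

lemma virAffBilin_zz (m n : ℤ) {X Y : C} (x : X ⟶ g) (y : Y ⟶ g) :
    (virAffBilin g).app (virAffZ g m x) (virAffZ g n y) =
      virAffZ g (m + n) ((x ⊗ₘ y) ≫ LieObj.bracket) +
        virAffK g (affCocycle m n • (x ⊗ₘ y) ≫ Quadratic.form) := by
  have h : (virAffBilin g).app (virAffZ g m x) (virAffZ g n y) =
      (coprod (virAffObj g)).res (x ⊗ₘ y)
        (virAffZ g (m + n) (LieObj.bracket (g := g)) +
          virAffK g (affCocycle m n • Quadratic.form (g := g))) := Bilin.ofComponents_app ..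
  rw [h, map_add, res_virAffZ, res_virAffK, Linear.comp_smul]

lemma virAffBilin_central_C {X : C} (x : X ⟶ 𝟙_ C) :
    Central (virAffBilin g) (virAffC g x) := by
  constructor <;> intro Y y <;> induction y using coprod_induction with
    | zero => simp
    | add x y hx hy => simp [hx, hy]
    | of i f => exact (Bilin.ofComponents_app ..).trans (by cases i <;> exact map_zero _)

lemma virAffBilin_central_K {X : C} (x : X ⟶ 𝟙_ C) :
    Central (virAffBilin g) (virAffK g x) := by
  constructor <;> intro Y y <;> induction y using coprod_induction with
    | zero => simp
    | add x y hx hy => simp [hx, hy]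
    | of i f => exact (Bilin.ofComponents_app ..).trans (by cases i <;> exact map_zero _)

lemma affCocycle_L₁ (l m n : ℤ) :
    0 = -(m : ℂ) * affCocycle (m + l) n + -(n : ℂ) * affCocycle m (n + l) := by
  unfold affCocycle
  rw [← add_assoc, show m + n + l = m + l + n by ring]
  split_ifs with h
  · obtain rfl : n = - m - l := by omega
    push_cast; ring
  · simp

lemma affCocycle_L₂ (l m n : ℤ) :
    -(n : ℂ) * affCocycle l (n + m) = l * affCocycle (l + m) n := by
  unfold affCocycle
  rw [← add_assoc, show l + n + m = l + m + n by ring]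
  split_ifs with h
  · obtain rfl : n = - l - m := by omega
    push_cast; ring
  · simp

lemma affCocycle_L₃ (l m n : ℤ) :
    (m : ℂ) * affCocycle l (m + n) = l * affCocycle m (l + n) := by
  unfold affCocycle
  rw [← add_assoc, ← add_assoc, add_comm m l]
  split_ifs with h
  · ring
  · simp

lemma virCocycle_jacobi (l m n : ℤ) :
    ((m : ℂ) - n) * virCocycle l (m + n) =
      ((l : ℂ) - m) * virCocycle (l + m) n + ((l : ℂ) - n) * virCocycle m (l + n) := by
  unfold virCocycle
  rw [← add_assoc, show m + (l + n) = l + m + n by ring]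
  split_ifs with h
  · obtain rfl : n = - l - m := by omega
    push_cast; ring
  · simp

lemma virAffBilin_jacobi (i j k : VirAffIdx) : Jacobi (virAffBilin g)
    (coprodι (virAffObj g) i (𝟙 _)) (coprodι (virAffObj g) j (𝟙 _))
    (coprodι (virAffObj g) k (𝟙 _)) := by
  have zzz (l m n : ℤ) : Jacobi (virAffBilin g)
      (virAffZ g l (𝟙 g)) (virAffZ g m (𝟙 g)) (virAffZ g n (𝟙 g)) := by
    unfold Jacobi
    simp only [virAffBilin_zz, (virAffBilin_central_K g _).1, (virAffBilin_central_K g _).2,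
      map_add, LinearMap.add_apply, add_zero, res_virAffZ, res_virAffK, id_tensorHom,
      tensorHom_id, id_whiskerRight, Category.id_comp]
    rw [affCocycle_jacobi l m n]
    simp only [Linear.comp_smul, form_swap, Quadratic.invariant, Iso.inv_hom_id_assoc, map_smul,
      map_neg]
    rw [← add_assoc l m n, show m + (l + n) = l + m + n by ring,
      congrArg (virAffZ g (l + m + n)) (LieObj.jacobi (g := g)), map_add]
    module
  have H (l m n : ℤ) :
      Jacobi (virAffBilin g) (virAffL g l (𝟙 _)) (virAffL g m (𝟙 _)) (virAffL g n (𝟙 _)) ∧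
      Jacobi (virAffBilin g) (virAffL g l (𝟙 _)) (virAffL g m (𝟙 _)) (virAffZ g n (𝟙 g)) ∧
      Jacobi (virAffBilin g) (virAffL g l (𝟙 _)) (virAffZ g m (𝟙 g)) (virAffL g n (𝟙 _)) ∧
      Jacobi (virAffBilin g) (virAffL g l (𝟙 _)) (virAffZ g m (𝟙 g)) (virAffZ g n (𝟙 g)) ∧
      Jacobi (virAffBilin g) (virAffZ g l (𝟙 g)) (virAffL g m (𝟙 _)) (virAffL g n (𝟙 _)) ∧
      Jacobi (virAffBilin g) (virAffZ g l (𝟙 g)) (virAffL g m (𝟙 _)) (virAffZ g n (𝟙 g)) ∧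
      Jacobi (virAffBilin g) (virAffZ g l (𝟙 g)) (virAffZ g m (𝟙 g)) (virAffL g n (𝟙 _)) := by
    have e₁ : l + (m + n) = l + m + n := by ring
    have e₂ : m + (l + n) = l + m + n := by ring
    have e₃ : n + m + l = l + m + n := by ring
    have e₄ : n + (l + m) = l + m + n := by ring
    have e₅ : n + l + m = l + m + n := by ring
    have e₆ : m + n + l = l + m + n := by ring
    have e₇ : m + l + n = l + m + n := by ring
    have e₈ : l + n + m = l + m + n := by ring
    have e₉ : m + (n + l) = l + m + n := by ring
    have e₀ : l + (n + m) = l + m + n := by ring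
    unfold Jacobi
    refine ⟨?_, ?_, ?_, ?_, ?_, ?_, ?_⟩ <;>
      simp only [virAffBilin_LL, virAffBilin_Lz, virAffBilin_zL, virAffBilin_zz,
        (virAffBilin_central_C g _).1, (virAffBilin_central_C g _).2,
        (virAffBilin_central_K g _).1, (virAffBilin_central_K g _).2,
        map_add, LinearMap.add_apply, add_zero, map_zero, smul_zero, res_virAffL, res_virAffC,
        res_virAffZ, res_virAffK, id_tensorHom, tensorHom_id, id_whiskerRight, Category.id_comp,
        map_smul, LinearMap.smul_apply, Linear.comp_smul, leftUnitor_naturality,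
        rightUnitor_naturality, reassoc_of% swapLeft_unit₁, reassoc_of% swapLeft_unit₂,
        reassoc_of% swapLeft_unit₃, reassoc_of% assoc_unit₁, reassoc_of% assoc_unit₂,
        reassoc_of% assoc_unit₃, LieObj.skew, Quadratic.symm, Preadditive.comp_neg, map_neg,
        ← unitors_equal, e₁, e₂, e₃, e₄, e₅, e₆, e₇, e₈, e₉, e₀, Int.cast_add]
    · linear_combination (norm := module) (virCocycle_jacobi l m n) •
        virAffC g ((λ_ (𝟙_ C ⊗ 𝟙_ C)).hom ≫ (λ_ (𝟙_ C)).hom)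
    · module
    · module
    · linear_combination (norm := module) (affCocycle_L₁ l m n) •
        virAffK g ((λ_ (g ⊗ g)).hom ≫ Quadratic.form)
    · module
    · linear_combination (norm := module) (affCocycle_L₂ l m n) •
        virAffK g (g ◁ (λ_ g).hom ≫ Quadratic.form)
    · linear_combination (norm := module) (affCocycle_L₃ l m n) •
        virAffK g (g ◁ (ρ_ g).hom ≫ Quadratic.form)
  have hc : Central (virAffBilin g) (coprodι (virAffObj g) .c (𝟙 (virAffObj g .c))) :=
    virAffBilin_central_C g _
  have hK : Central (virAffBilin g) (coprodι (virAffObj g) .K (𝟙 (virAffObj g .K))) :=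
    virAffBilin_central_K g _
  rcases i with l | - | l | -
  case c => exact jacobi_of_central _ _ _ _ (.inl hc)
  case K => exact jacobi_of_central _ _ _ _ (.inl hK)
  all_goals
    rcases j with m | - | m | -
    case c => exact jacobi_of_central _ _ _ _ (.inr (.inl hc))
    case K => exact jacobi_of_central _ _ _ _ (.inr (.inl hK))
    all_goals
      rcases k with n | - | n | -
      case c => exact jacobi_of_central _ _ _ _ (.inr (.inr hc))
      case K => exact jacobi_of_central _ _ _ _ (.inr (.inr hK))
  · exact (H l m n).1
  · exact (H l m n).2.1
  · exact (H l m n).2.2.1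
  · exact (H l m n).2.2.2.1
  · exact (H l m n).2.2.2.2.1
  · exact (H l m n).2.2.2.2.2.1
  · exact (H l m n).2.2.2.2.2.2
  · exact zzz l m n

/-- The affine Lie algebra `ĝ = g[z, z⁻¹] ⊕ 𝟙`. -/
def affine : LieAlg C :=
  LieAlg.ofComponents (affObj g) (affBracket g) (affBracket_skew g) (affBilin_jacobi g)

/-- The semidirect product `Vir ⋉ ĝ`. -/
def virAffine : LieAlg C :=
  LieAlg.ofComponents (virAffObj g) (virAffBracket g) (virAffBracket_skew g)
    (virAffBilin_jacobi g)

/-- The inclusion of `ĝ` in `Vir ⋉ ĝ`. -/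
def affIncl {X : C} : (affine g).obj.El X →ₗ[ℂ] (virAffine g).obj.El X :=
  coprodDesc (affObj g) fun
    | .z n => virAffZ g n
    | .K => virAffK g

end LieObjects

section Modules

variable {C : Type u} [Category.{v} C] [Abelian C] [Linear ℂ C] [MonoidalCategory C]
  [SymmetricCategory C] [RigidCategory C] [MonoidalPreadditive C] [MonoidalLinear ℂ C]
  {g : C} [LieObj g] [Quadratic g] {M : IndObj C}

namespace LieMod

/-- The action `g zⁿ ⊗ M ⟶ M`, as an operation on elements of `M`. -/
def zAct (ρ : LieMod (affine g) M) (n : ℤ) {X : C} : M.El X →ₗ[ℂ] M.El (g ⊗ X) :=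
  ρ.act.app (affZ g n (𝟙 g))

/-- The module `M` is of level `k`: the central subobject `𝟙` of `ĝ` acts by `k`. -/
def HasLevel (ρ : LieMod (affine g) M) (k : ℂ) : Prop :=
  ∀ (X : C) (m : M.El X), ρ.act.app (affK g (𝟙 (𝟙_ C))) m = k • M.res (λ_ X).hom m

/-- For every `C`-subobject `X` of `M`, the action `g zⁿ ⊗ X ⟶ M` vanishes for large `n`. -/
def IsAdmissible (ρ : LieMod (affine g) M) : Prop :=
  ∀ (X : C) (x : M.El X), M.IsSubobject x → ∃ N : ℕ, ∀ n : ℤ, N ≤ n → ρ.zAct n x = 0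

/-- The action on `M` of the product of a tensor `t : 𝟙 ⟶ g ⊗ g` times `zⁱ ⊗ zʲ`. -/
def quadAct (ρ : LieMod (affine g) M) (t : 𝟙_ C ⟶ g ⊗ g) (i j : ℤ) {X : C} :
    M.El X →ₗ[ℂ] M.El X :=
  M.res ((λ_ X).inv ≫ t ▷ X ≫ (α_ g g X).hom) ∘ₗ ρ.zAct i ∘ₗ ρ.zAct j

/-- The action on `M` of `C_{ij}(k)`, which is the product of `B_k⁻¹` times `zⁱ ⊗ zʲ` if `i ≤ j`,
and `C_{ji}(k)` otherwise. -/
def sugawaraAct (ρ : LieMod (affine g) M) {k : ℂ} (hk : IsNonCritical g k) (i j : ℤ) {X : C} :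
    M.El X →ₗ[ℂ] M.El X :=
  ρ.quadAct (copairing (levelForm g k) hk) (min i j) (max i j)

/-- The operator `Lₙ` on a module over `Vir ⋉ ĝ`. -/
def L (σ : LieMod (virAffine g) M) (n : ℤ) {X : C} : M.El X →ₗ[ℂ] M.El X :=
  M.res (λ_ X).inv ∘ₗ σ.act.app (virAffL g n (𝟙 (𝟙_ C)))

/-- The central element `c` of `Vir` acts by the scalar `a`. -/
def HasCentralCharge (σ : LieMod (virAffine g) M) (a : ℂ) : Prop :=
  ∀ (X : C) (m : M.El X), σ.act.app (virAffC g (𝟙 (𝟙_ C))) m = a • M.res (λ_ X).hom m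

/-- The action of `Vir ⋉ ĝ` extends the one of `ĝ`. -/
def Extends (σ : LieMod (virAffine g) M) (ρ : LieMod (affine g) M) : Prop :=
  ∀ (X Y : C) (a : (affine g).obj.El X) (m : M.El Y),
    σ.act.app (affIncl g a) m = ρ.act.app a m

end LieMod

end Modules

end SymTensor

end

open SymTensor

/-! Write `B_k⁻¹ = ∑ eₐ ⊗ eᵃ`, let `Cas x = ∑ [eₐ, [eᵃ, x]]`, and let `E(i, j) = ∑ (eₐ zⁱ)(eᵃ zʲ)`
act on `M` (`quadAct`).

The Killing form is a trace, so it can be computed with dual bases of any nondegenerate symmetric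
invariant form `b`: `Kil(x, y) = b(x, Cas y)` for the Casimir operator of `b`
(`IsDualPair.formLeft_killing`). With `b = B` this shows that `Kil` is symmetric and invariant,
since the Casimir operator is self-adjoint and commutes with the adjoint action; hence `B_k` is
symmetric and invariant. With `b = B_k` it gives `k ∑ B(eᵃ, x) eₐ + (1/2) Cas x = x`
(`copairing_form_add_casimir`). This identity explains the shift of the level by half the Killing
form.

Up to reordering, `Lₙ` is half the sum of the tails `j > n` and `j ≥ 0` of the one function `j ↦ E(n
- j, j)`. Admissibility makes the tails finite on each element. Commuting `E(n - j, j)` with `x zᵖ`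
produces a difference `f (j + p) - f j`, so each tail collapses to a window of length `p`. The
reflection `j ↦ n + p - j` exchanges the two windows, and `f (n + p - j) + f j` is the action of
`Cas x` in degree `n + p`. Together with the cocycle terms and the identity above, this yields `[Lₙ,
x zᵖ] = -p x zⁿ⁺ᵖ` (`sugawaraOp_zAct`).

Therefore `L_p` acts on each `E(i, j)` as a derivation, and `[L_p, Lₙ]` is found by the same
telescoping with linear weights (`sugawaraOp_comm`). The windows now contribute only through `E(j,
-j) - E(-j, j) = j k d`, where `d = B ∘ B_k⁻¹`; the sum `∑ j (p - j) = (p³ - p)/6` over `0 ≤ j < p`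
produces the Virasoro cocycle with central charge `k d`. -/

noncomputable section

namespace SymTensor

/-! ### Tensor calculus beside a spectator object `X` -/

section Calculus

variable {C : Type u} [Category.{v} C] [MonoidalCategory C]

/-- `x ⊗ y ⊗ z ↦ f(x, y) ⊗ z`. -/
def bracketLeft {g : C} (f : g ⊗ g ⟶ g) (X : C) : g ⊗ (g ⊗ X) ⟶ g ⊗ X :=
  (α_ g g X).inv ≫ f ▷ X

/-- `x ⊗ y ⊗ z ↦ b(x, y) z`. -/
def formLeft {g : C} (b : g ⊗ g ⟶ 𝟙_ C) (X : C) : g ⊗ (g ⊗ X) ⟶ X :=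
  (α_ g g X).inv ≫ b ▷ X ≫ (λ_ X).hom

/-- `x ↦ t ⊗ x`. -/
def copairingLeft {g : C} (t : 𝟙_ C ⟶ g ⊗ g) (X : C) : X ⟶ g ⊗ (g ⊗ X) :=
  (λ_ X).inv ≫ t ▷ X ≫ (α_ g g X).hom

variable {g : C} (f : g ⊗ g ⟶ g) (b : g ⊗ g ⟶ 𝟙_ C) (t : 𝟙_ C ⟶ g ⊗ g) {X Y : C}

lemma bracketLeft_naturality (h : X ⟶ Y) :
    g ◁ g ◁ h ≫ bracketLeft f Y = bracketLeft f X ≫ g ◁ h := by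
  simp only [bracketLeft, associator_inv_naturality_right_assoc, whisker_exchange, Category.assoc]

lemma formLeft_naturality (h : X ⟶ Y) :
    g ◁ g ◁ h ≫ formLeft b Y = formLeft b X ≫ h := by
  simp only [formLeft, associator_inv_naturality_right_assoc, whisker_exchange_assoc,
    leftUnitor_naturality, Category.assoc]

lemma copairingLeft_naturality (h : X ⟶ Y) :
    copairingLeft t X ≫ g ◁ g ◁ h = h ≫ copairingLeft t Y := by
  simp only [copairingLeft, ← associator_naturality_right, ← whisker_exchange_assoc,
    leftUnitor_inv_naturality_assoc, Category.assoc]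

variable [SymmetricCategory C]

lemma swapLeft_whiskerLeft (X Y : C) {Z Z' : C} (h : Z ⟶ Z') :
    X ◁ Y ◁ h ≫ swapLeft X Y Z' = swapLeft X Y Z ≫ Y ◁ X ◁ h := by
  simpa using swapLeft_naturality (𝟙 X) (𝟙 Y) h

lemma swapLeft_whiskerRight (X : C) {Y Y' : C} (h : Y ⟶ Y') (Z : C) :
    X ◁ h ▷ Z ≫ swapLeft X Y' Z = swapLeft X Y Z ≫ h ▷ (X ⊗ Z) := by
  simpa using swapLeft_naturality (𝟙 X) h (𝟙 Z)

lemma swapLeft_swapLeft (X Y Z : C) : swapLeft X Y Z ≫ swapLeft Y X Z = 𝟙 _ := by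
  simp [swapLeft, ← comp_whiskerRight_assoc]

/-- The hexagon axiom. Combined with naturality, it lets a factor slide past a bracket, a form or a
copairing in the lemmas below. -/
lemma swapLeft_tensor (X Y Z W : C) : swapLeft X (Y ⊗ Z) W =
    X ◁ (α_ Y Z W).hom ≫ swapLeft X Y (Z ⊗ W) ≫ Y ◁ swapLeft X Z W ≫ (α_ Y Z (X ⊗ W)).inv := by
  simp only [swapLeft, BraidedCategory.braiding_tensor_right_hom]
  monoidal

lemma whiskerLeft_bracketLeft_swapLeft (X : C) : g ◁ bracketLeft f X ≫ swapLeft g g X =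
    swapLeft g g (g ⊗ X) ≫ g ◁ swapLeft g g X ≫ bracketLeft f (g ⊗ X) := by
  simp only [bracketLeft, MonoidalCategory.whiskerLeft_comp, Category.assoc,
    swapLeft_whiskerRight, swapLeft_tensor, Iso.inv_hom_id_assoc, whiskerLeft_inv_hom_assoc]

lemma whiskerLeft_formLeft (X : C) : g ◁ formLeft b X =
    swapLeft g g (g ⊗ X) ≫ g ◁ swapLeft g g X ≫ formLeft b (g ⊗ X) := by
  have h := swapLeft_tensor g g g X
  have h' := swapLeft_whiskerRight g b X
  rw [h] at h'
  simp only [formLeft, MonoidalCategory.whiskerLeft_comp, ← swapLeft_unit₂, Category.assoc]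
  rw [reassoc_of% h']
  simp

/-- Inserting `t` to the right of `x` is inserting it to the left and then sliding `x` leftwards
past both legs; braiding with the unit object is trivial. -/
lemma whiskerLeft_copairingLeft (X : C) : g ◁ copairingLeft t X =
    copairingLeft t (g ⊗ X) ≫ g ◁ swapLeft g g X ≫ swapLeft g g (g ⊗ X) := by
  have h := swapLeft_tensor g g g X
  have h' := swapLeft_whiskerRight g t X
  rw [h] at h'
  have e : g ◁ (λ_ X).inv ≫ swapLeft g (𝟙_ C) X = (λ_ (g ⊗ X)).inv := by
    rw [← cancel_mono (λ_ (g ⊗ X)).hom, Category.assoc, swapLeft_unit₂]; simp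
  have h'' : g ◁ t ▷ X ≫ g ◁ (α_ g g X).hom = swapLeft g (𝟙_ C) X ≫ t ▷ (g ⊗ X) ≫
      (α_ g g (g ⊗ X)).hom ≫ g ◁ swapLeft g g X ≫ swapLeft g g (g ⊗ X) := by
    rw [← reassoc_of% h']
    simp only [Iso.inv_hom_id_assoc, Category.assoc]
    rw [← MonoidalCategory.whiskerLeft_comp_assoc g (swapLeft g g X), swapLeft_swapLeft]
    simp [swapLeft_swapLeft]
  simp only [copairingLeft, MonoidalCategory.whiskerLeft_comp, Category.assoc, h'',
    reassoc_of% e]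

lemma copairingLeft_swapLeft_swapLeft (X : C) :
    g ◁ copairingLeft t X ≫ swapLeft g g (g ⊗ X) ≫ g ◁ swapLeft g g X =
      copairingLeft t (g ⊗ X) := by
  rw [whiskerLeft_copairingLeft]
  simp only [Category.assoc, reassoc_of% (swapLeft_swapLeft g g (g ⊗ X)),
    ← MonoidalCategory.whiskerLeft_comp, swapLeft_swapLeft]
  simp

lemma swapLeft_formLeft (hb : (β_ g g).hom ≫ b = b) (X : C) :
    swapLeft g g X ≫ formLeft b X = formLeft b X := by
  simp only [swapLeft, formLeft, Category.assoc, Iso.hom_inv_id_assoc]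
  rw [← comp_whiskerRight_assoc, hb]

end Calculus

/-! ### Zigzag identities for a form and its inverse, and the Killing form as a trace over dual
bases -/

section Duality

variable {C : Type u} [Category.{v} C] [Abelian C] [Linear ℂ C] [MonoidalCategory C]
  [SymmetricCategory C] [RigidCategory C] {g : C}

/-- The exchange law brings the coevaluation inside `toDual` next to the evaluation, and the
triangle identity removes both. -/
lemma toDual_evaluation (b : g ⊗ g ⟶ 𝟙_ C) : toDual b ▷ g ≫ ε_ g (gᘁ : C) = b := by
  have h := ExactPairing.evaluation_coevaluation g (gᘁ : C)
  have h₁ : toDual b ▷ g ≫ ε_ g (gᘁ : C) = 𝟙 (g ⊗ g) ⊗≫ g ◁ (η_ g (gᘁ : C) ▷ g) ⊗≫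
      (b ▷ ((gᘁ : C) ⊗ g) ≫ 𝟙_ C ◁ ε_ g (gᘁ : C)) ⊗≫ 𝟙 _ := by
    simp only [toDual]; monoidal
  rw [h₁, ← whisker_exchange]
  have h₂ : 𝟙 (g ⊗ g) ⊗≫ g ◁ (η_ g (gᘁ : C) ▷ g) ⊗≫
      ((g ⊗ g) ◁ ε_ g (gᘁ : C) ≫ b ▷ 𝟙_ C) ⊗≫ 𝟙 _ =
      𝟙 _ ⊗≫ g ◁ (η_ g (gᘁ : C) ▷ g ≫ (α_ _ _ _).hom ≫ g ◁ ε_ g (gᘁ : C)) ⊗≫ b := by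
    monoidal
  rw [h₂, h]
  monoidal

variable (b : g ⊗ g ⟶ 𝟙_ C) (hb : Nondegenerate b)

lemma copairing_toDual : copairing b hb ≫ g ◁ toDual b = η_ g (gᘁ : C) := by
  have : IsIso (toDual b) := hb
  change (η_ g (gᘁ : C) ≫ g ◁ inv (toDual b)) ≫ g ◁ toDual b = _
  rw [Category.assoc, ← MonoidalCategory.whiskerLeft_comp, IsIso.inv_hom_id,
    MonoidalCategory.whiskerLeft_id, Category.comp_id]

/-- The first zigzag, `∑ b(x, eₐ) eᵃ = x`: after an exchange the left side is `toDual b` followed by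
its inverse. -/
lemma copairing_formLeft (X : C) :
    g ◁ copairingLeft (copairing b hb) X ≫ formLeft b (g ⊗ X) = 𝟙 _ := by
  have : IsIso (toDual b) := hb
  have h₁ : g ◁ copairingLeft (copairing b hb) X ≫ formLeft b (g ⊗ X) =
      𝟙 _ ⊗≫ (g ◁ η_ g (gᘁ : C)) ▷ X ⊗≫ (((g ⊗ g) ◁ inv (toDual b)) ≫ b ▷ g) ▷ X ⊗≫ 𝟙 _ := by
    simp only [copairingLeft, formLeft, copairing]; monoidal
  rw [h₁, whisker_exchange]
  have h₂ : 𝟙 _ ⊗≫ (g ◁ η_ g (gᘁ : C)) ▷ X ⊗≫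
      (b ▷ (gᘁ : C) ≫ 𝟙_ C ◁ inv (toDual b)) ▷ X ⊗≫ 𝟙 _ =
      (toDual b ≫ inv (toDual b)) ▷ X := by
    simp only [toDual]; monoidal
  rw [h₂]; simp

/-- The second zigzag, `∑ b(eᵃ, x) eₐ = x`: composing `b` with the inverse of `toDual b` gives the
evaluation, so this is the triangle identity for `g` and its dual. -/
lemma copairingLeft_form (X : C) :
    copairingLeft (copairing b hb) (g ⊗ X) ≫ g ◁ formLeft b X = 𝟙 _ := by
  have : IsIso (toDual b) := hb
  have e : inv (toDual b) ▷ g ≫ b = ε_ g (gᘁ : C) := by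
    rw [← cancel_epi (toDual b ▷ g), toDual_evaluation, ← comp_whiskerRight_assoc,
      IsIso.hom_inv_id, id_whiskerRight, Category.id_comp]
  have h₁ : copairingLeft (copairing b hb) (g ⊗ X) ≫ g ◁ formLeft b X =
      𝟙 _ ⊗≫ (η_ g (gᘁ : C) ▷ g ≫ (α_ _ _ _).hom ≫ g ◁ (inv (toDual b) ▷ g ≫ b)) ▷ X ⊗≫ 𝟙 _ := by
    simp only [copairingLeft, formLeft, copairing]; monoidal
  rw [h₁, e, ExactPairing.evaluation_coevaluation]
  monoidal

/-- The trace in terms of `b`: `Kil(x, y) = ∑ b([x, [y, eₐ]], eᵃ)`. The coevaluation is `copairing`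
followed by `toDual`; the latter slides past both brackets and turns the braided evaluation into
`b`, by symmetry. -/
lemma killing_eq [LieObj g] (hs : (β_ g g).hom ≫ b = b) :
    killing g = (ρ_ (g ⊗ g)).inv ≫ (g ⊗ g) ◁ copairing b hb ≫ (α_ g g (g ⊗ g)).hom ≫
    g ◁ ((α_ g g g).inv ≫ LieObj.bracket ▷ g) ≫ (α_ g g g).inv ≫ LieObj.bracket ▷ g ≫ b := by
  have e : g ◁ toDual b ≫ (β_ g (gᘁ : C)).hom ≫ ε_ g (gᘁ : C) = b := by
    rw [BraidedCategory.braiding_naturality_right_assoc, toDual_evaluation, hs]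
  have h : (α_ g g g).inv ≫ LieObj.bracket ▷ g ≫ g ◁ toDual b =
      g ◁ g ◁ toDual b ≫ (α_ g g (gᘁ : C)).inv ≫ LieObj.bracket ▷ (gᘁ : C) := by
    simp only [associator_inv_naturality_right_assoc, whisker_exchange]
  have h' : g ◁ (α_ g g g).inv ≫ g ◁ LieObj.bracket ▷ g ≫ g ◁ g ◁ toDual b =
      g ◁ g ◁ g ◁ toDual b ≫ g ◁ (α_ g g (gᘁ : C)).inv ≫ g ◁ LieObj.bracket ▷ (gᘁ : C) := by
    simp only [← MonoidalCategory.whiskerLeft_comp, h]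
  rw [killing, ← copairing_toDual b hb]
  simp only [MonoidalCategory.whiskerLeft_comp, Category.assoc,
    associator_naturality_right_assoc]
  rw [← reassoc_of% h', ← reassoc_of% h, e]

lemma formLeft_killing [LieObj g] (hs : (β_ g g).hom ≫ b = b) (X : C) :
    formLeft (killing g) X = g ◁ g ◁ copairingLeft (copairing b hb) X ≫
      g ◁ bracketLeft LieObj.bracket (g ⊗ X) ≫ bracketLeft LieObj.bracket (g ⊗ X) ≫
        formLeft b X := by
  rw [killing_eq b hb hs]
  simp only [formLeft, copairingLeft, bracketLeft]
  monoidal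

end Duality

/-! ### The Casimir operator, invariance of the Killing form, and the identity defining the level
shift -/

section Casimir

variable {C : Type u} [Category.{v} C] [Abelian C] [Linear ℂ C] [MonoidalCategory C]
  [SymmetricCategory C] {g : C}

/-- `b` is a symmetric invariant form on the Lie algebra `g`, and `t` is inverse to `b`. -/
structure IsDualPair [LieObj g] (b : g ⊗ g ⟶ 𝟙_ C) (t : 𝟙_ C ⟶ g ⊗ g) : Prop where
  symm : (β_ g g).hom ≫ b = b
  invariant : ∀ X : C, bracketLeft LieObj.bracket (g ⊗ X) ≫ formLeft b X =
    g ◁ bracketLeft LieObj.bracket X ≫ formLeft b X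
  copairing_form : ∀ X : C, g ◁ copairingLeft t X ≫ formLeft b (g ⊗ X) = 𝟙 _
  form_copairing : ∀ X : C, copairingLeft t (g ⊗ X) ≫ g ◁ formLeft b X = 𝟙 _

/-- The Casimir operator `x ⊗ y ↦ [eᵢ, [eⁱ, x]] ⊗ y` attached to `t = eᵢ ⊗ eⁱ`. -/
def casimirLeft [LieObj g] (t : 𝟙_ C ⟶ g ⊗ g) (X : C) : g ⊗ X ⟶ g ⊗ X :=
  copairingLeft t (g ⊗ X) ≫ g ◁ bracketLeft LieObj.bracket X ≫ bracketLeft LieObj.bracket X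

variable [LieObj g]

lemma casimirLeft_naturality (t : 𝟙_ C ⟶ g ⊗ g) {X Y : C} (h : X ⟶ Y) :
    g ◁ h ≫ casimirLeft t Y = casimirLeft t X ≫ g ◁ h := by
  have h₁ := copairingLeft_naturality t (g ◁ h)
  have h₂ := congrArg (g ◁ ·) (bracketLeft_naturality (g := g) LieObj.bracket h)
  simp only [MonoidalCategory.whiskerLeft_comp] at h₂
  simp only [casimirLeft, ← reassoc_of% h₁, Category.assoc, reassoc_of% h₂,
    bracketLeft_naturality]

lemma casimirLeft_swapLeft (t : 𝟙_ C ⟶ g ⊗ g) (X : C) :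
    g ◁ casimirLeft t X ≫ swapLeft g g X = swapLeft g g X ≫ casimirLeft t (g ⊗ X) := by
  have h₁ : g ◁ bracketLeft (g := g) LieObj.bracket X ≫ swapLeft g g X = _ :=
    whiskerLeft_bracketLeft_swapLeft _ X
  have h₂ := swapLeft_whiskerLeft g g (bracketLeft (g := g) LieObj.bracket X)
  have h₃ := congrArg (g ◁ ·) h₁
  have h₄ := copairingLeft_naturality t (swapLeft g g X)
  simp only [MonoidalCategory.whiskerLeft_comp] at h₃
  simp only [casimirLeft, MonoidalCategory.whiskerLeft_comp, Category.assoc, h₁,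
    reassoc_of% h₂, reassoc_of% h₃, ← reassoc_of% h₄,
    reassoc_of% copairingLeft_swapLeft_swapLeft t (g ⊗ X)]

variable [MonoidalPreadditive C]

lemma whiskerLeft_neg' (X : C) {Y Z : C} (f : Y ⟶ Z) : X ◁ (-f) = - X ◁ f :=
  (tensorLeft X).map_neg

lemma whiskerRight_neg' {Y Z : C} (f : Y ⟶ Z) (X : C) : (-f) ▷ X = - f ▷ X :=
  (tensorRight X).map_neg

lemma bracketLeft_jacobi (X : C) :
    g ◁ bracketLeft (g := g) LieObj.bracket X ≫ bracketLeft LieObj.bracket X =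
      bracketLeft LieObj.bracket (g ⊗ X) ≫ bracketLeft LieObj.bracket X +
      swapLeft g g (g ⊗ X) ≫ g ◁ bracketLeft LieObj.bracket X ≫
        bracketLeft LieObj.bracket X := by
  have h₁ : g ◁ bracketLeft (g := g) LieObj.bracket X ≫ bracketLeft LieObj.bracket X =
      𝟙 (g ⊗ (g ⊗ (g ⊗ X))) ⊗≫ (g ◁ LieObj.bracket ≫ LieObj.bracket) ▷ X := by
    simp only [bracketLeft]; monoidal
  refine h₁.trans ?_
  rw [LieObj.jacobi, MonoidalPreadditive.add_whiskerRight]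
  simp only [bracketLeft, swapLeft, monoidalComp, Preadditive.comp_add]
  congr 1 <;> monoidal

lemma swapLeft_bracketLeft (X : C) :
    swapLeft g g X ≫ bracketLeft LieObj.bracket X = - bracketLeft LieObj.bracket X := by
  simp only [swapLeft, bracketLeft, Category.assoc, Iso.hom_inv_id_assoc]
  rw [← comp_whiskerRight, LieObj.skew, whiskerRight_neg', Preadditive.comp_neg]

/-- The Casimir operator commutes with the adjoint action. -/
lemma casimirLeft_bracketLeft_of_invariant (t : 𝟙_ C ⟶ g ⊗ g)
    (ht : ∀ X : C, copairingLeft t (g ⊗ X) ≫ g ◁ bracketLeft LieObj.bracket X =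
      g ◁ copairingLeft t X ≫ bracketLeft LieObj.bracket (g ⊗ X)) (X : C) :
    casimirLeft t (g ⊗ X) ≫ bracketLeft LieObj.bracket X =
      bracketLeft LieObj.bracket X ≫ casimirLeft t X := by
  have J := bracketLeft_jacobi (g := g) X
  have J' := congrArg (g ◁ ·) J
  have n₁ := bracketLeft_naturality (g := g) LieObj.bracket (bracketLeft (g := g) LieObj.bracket X)
  have n₂ := swapLeft_whiskerLeft g g (bracketLeft (g := g) LieObj.bracket X)
  have n₃ := copairingLeft_naturality t (bracketLeft (g := g) LieObj.bracket X)
  have s₁ := congrArg (g ◁ ·) (swapLeft_bracketLeft (g := g) (g ⊗ X))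
  have c := copairingLeft_swapLeft_swapLeft t (g ⊗ X)
  simp only [MonoidalCategory.whiskerLeft_comp, MonoidalPreadditive.whiskerLeft_add,
    whiskerLeft_neg'] at J' s₁
  have T : copairingLeft t (g ⊗ (g ⊗ X)) ≫ g ◁ bracketLeft (g := g) LieObj.bracket (g ⊗ X) =
      - g ◁ copairingLeft t (g ⊗ X) ≫ swapLeft g g (g ⊗ (g ⊗ X)) ≫
        g ◁ bracketLeft LieObj.bracket (g ⊗ X) := by
    rw [← c, Category.assoc, Category.assoc, s₁]
    simp
  -- Applying Jacobi twice, `[x, [eₐ, [eᵃ, y]]] = [[x, eₐ], [eᵃ, y]] + [eₐ, [[x, eᵃ], y]] + [eₐ,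
  -- [eᵃ, [x, y]]]`. Invariance `ht` turns the first term into `[eₐ, [[eᵃ, x], y]]`, which cancels
  -- the second. The version with the Casimir operator on the other argument follows by
  -- skew-symmetry.
  have left : g ◁ casimirLeft t X ≫ bracketLeft LieObj.bracket X =
      bracketLeft LieObj.bracket X ≫ casimirLeft t X := by
    simp only [casimirLeft, MonoidalCategory.whiskerLeft_comp, Category.assoc]
    conv_lhs => rw [J]
    simp only [Preadditive.comp_add]
    rw [reassoc_of% n₁, ← reassoc_of% ht (g ⊗ X), reassoc_of% n₂, reassoc_of% J']
    simp only [Preadditive.comp_add, Preadditive.add_comp, Category.assoc]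
    rw [reassoc_of% c, reassoc_of% n₃, reassoc_of% T]
    simp only [Preadditive.neg_comp, Category.assoc]
    abel
  have s₂ := swapLeft_bracketLeft (g := g) X
  have e : casimirLeft t (g ⊗ X) = swapLeft g g X ≫ g ◁ casimirLeft t X ≫ swapLeft g g X := by
    rw [casimirLeft_swapLeft, reassoc_of% swapLeft_swapLeft]
  rw [e, Category.assoc, Category.assoc, s₂, Preadditive.comp_neg, left, Preadditive.comp_neg,
    reassoc_of% s₂, Preadditive.neg_comp, neg_neg]

namespace IsDualPair

variable {b : g ⊗ g ⟶ 𝟙_ C} {t : 𝟙_ C ⟶ g ⊗ g}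

/-- Nondegeneracy in usable form: the zigzag recovers a morphism into `g ⊗ X` from its pairing with
`b`. -/
lemma hom_ext (h : IsDualPair b t) {X Y : C} {φ ψ : Y ⟶ g ⊗ X}
    (H : g ◁ φ ≫ formLeft b X = g ◁ ψ ≫ formLeft b X) : φ = ψ := by
  have key (χ : Y ⟶ g ⊗ X) : χ = copairingLeft t Y ≫ g ◁ (g ◁ χ ≫ formLeft b X) := by
    rw [MonoidalCategory.whiskerLeft_comp, reassoc_of% copairingLeft_naturality t χ,
      h.form_copairing, Category.comp_id]
  rw [key φ, H, ← key ψ]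

/-- The inverse of a symmetric form is symmetric. -/
lemma copairingLeft_swapLeft (h : IsDualPair b t) (X : C) :
    copairingLeft t X ≫ swapLeft g g X = copairingLeft t X := by
  refine h.hom_ext ?_
  have s := congrArg (g ◁ ·) (swapLeft_formLeft b h.symm X)
  simp only [MonoidalCategory.whiskerLeft_comp] at s
  rw [h.copairing_form, MonoidalCategory.whiskerLeft_comp, whiskerLeft_copairingLeft,
    Category.assoc, Category.assoc, Category.assoc, ← whiskerLeft_formLeft, s, h.form_copairing]

/-- `eᵢ ⊗ [eⁱ, x] = [x, eᵢ] ⊗ eⁱ`. -/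
lemma copairing_invariant (h : IsDualPair b t) (X : C) :
    copairingLeft t (g ⊗ X) ≫ g ◁ bracketLeft LieObj.bracket X =
      g ◁ copairingLeft t X ≫ bracketLeft LieObj.bracket (g ⊗ X) := by
  -- Paired with `y`, both sides become `[y, x]`: directly on the left, and on the right because
  -- `b(y, [x, eₐ]) eᵃ = b([y, x], eₐ) eᵃ`.
  refine h.hom_ext ?_
  simp only [MonoidalCategory.whiskerLeft_comp, Category.assoc]
  rw [formLeft_naturality, reassoc_of% h.copairing_form, ← h.invariant,
    reassoc_of% bracketLeft_naturality, h.copairing_form, Category.comp_id]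

/-- `[eᵢ, x] ⊗ eⁱ = - [x, eᵢ] ⊗ eⁱ`. -/
lemma copairing_swapLeft_bracketLeft (h : IsDualPair b t) (X : C) :
    copairingLeft t (g ⊗ X) ≫ g ◁ swapLeft g g X ≫ bracketLeft LieObj.bracket (g ⊗ X) =
      - copairingLeft t (g ⊗ X) ≫ g ◁ bracketLeft LieObj.bracket X := by
  rw [h.copairing_invariant, whiskerLeft_copairingLeft, Category.assoc, Category.assoc,
    swapLeft_bracketLeft]
  simp

/-- `eᵢ ⊗ [eⁱ, x]` is antisymmetric. -/
lemma copairing_bracketLeft_swapLeft (h : IsDualPair b t) (X : C) :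
    (copairingLeft t (g ⊗ X) ≫ g ◁ bracketLeft LieObj.bracket X) ≫ swapLeft g g X =
      - copairingLeft t (g ⊗ X) ≫ g ◁ bracketLeft LieObj.bracket X := by
  rw [Category.assoc, whiskerLeft_bracketLeft_swapLeft,
    reassoc_of% h.copairingLeft_swapLeft, h.copairing_swapLeft_bracketLeft]

/-- Only the symmetry of `t` enters, so `b'` is arbitrary; it is applied with `b' = B` while `t` is
inverse to `B_k`. -/
lemma copairing_formLeft_swap (h : IsDualPair b t) (b' : g ⊗ g ⟶ 𝟙_ C) (X : C) :
    copairingLeft t (g ⊗ X) ≫ g ◁ swapLeft g g X ≫ formLeft b' (g ⊗ X) =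
      copairingLeft t (g ⊗ X) ≫ g ◁ formLeft b' X := by
  rw [whiskerLeft_formLeft, reassoc_of% h.copairingLeft_swapLeft]

/-- Self-adjointness of the Casimir operator: two uses of the invariance of `b` give `b(x, [eₐ, [eᵃ,
y]]) = b([[x, eₐ], eᵃ], y)`, and the invariance of `t` rewrites `[x, eₐ] ⊗ eᵃ` as `eₐ ⊗ [eᵃ, x]`. -/
lemma formLeft_casimirLeft (h : IsDualPair b t) (X : C) :
    casimirLeft t (g ⊗ X) ≫ formLeft b X = g ◁ casimirLeft t X ≫ formLeft b X := by
  simp only [casimirLeft, MonoidalCategory.whiskerLeft_comp, Category.assoc]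
  rw [← h.invariant, reassoc_of% bracketLeft_naturality, ← h.invariant,
    reassoc_of% h.copairing_invariant]

variable [RigidCategory C]

lemma of_nondegenerate (hb : Nondegenerate b) (hs : (β_ g g).hom ≫ b = b)
    (hi : ∀ X : C, bracketLeft LieObj.bracket (g ⊗ X) ≫ formLeft b X =
      g ◁ bracketLeft LieObj.bracket X ≫ formLeft b X) : IsDualPair b (copairing b hb) :=
  ⟨hs, hi, copairing_formLeft b hb, copairingLeft_form b hb⟩

/-- From `Kil(x, y) = ∑ b([x, [y, eₐ]], eᵃ)` by invariance of `t` and `b`. The form `b` is free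
here, which allows both `b = B` and `b = B_k` below. -/
lemma formLeft_killing (hb : Nondegenerate b) (h : IsDualPair b (copairing b hb)) (X : C) :
    formLeft (killing g) X = g ◁ casimirLeft (copairing b hb) X ≫ formLeft b X := by
  have e := congrArg (g ◁ ·) (h.copairing_invariant X)
  simp only [MonoidalCategory.whiskerLeft_comp] at e
  rw [SymTensor.formLeft_killing b hb h.symm, ← reassoc_of% e, h.invariant]
  simp only [casimirLeft, MonoidalCategory.whiskerLeft_comp, Category.assoc]

end IsDualPair

lemma form_ext {b b' : g ⊗ g ⟶ 𝟙_ C}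
    (h : formLeft b (𝟙_ C) = formLeft b' (𝟙_ C)) : b = b' := by
  have e (b : g ⊗ g ⟶ 𝟙_ C) : b = g ◁ (ρ_ g).inv ≫ formLeft b (𝟙_ C) := by
    simp only [formLeft]; monoidal
  rw [e b, h, ← e b']

variable [RigidCategory C] [MonoidalLinear ℂ C] [Quadratic g]

lemma isDualPair_form :
    IsDualPair (Quadratic.form (g := g)) (copairing _ Quadratic.nondegenerate) := by
  refine .of_nondegenerate _ Quadratic.symm fun X => ?_
  have h₁ : bracketLeft LieObj.bracket (g ⊗ X) ≫ formLeft (Quadratic.form (g := g)) X =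
      𝟙 (g ⊗ (g ⊗ (g ⊗ X))) ⊗≫ (LieObj.bracket ▷ g ≫ Quadratic.form) ▷ X ⊗≫ 𝟙 _ := by
    simp only [bracketLeft, formLeft]; monoidal
  rw [h₁, Quadratic.invariant]
  simp only [bracketLeft, formLeft]; monoidal

/-- `Kil(x, y) = B(x, Cas y)` with the Casimir operator of `B` self-adjoint and `B` symmetric. -/
lemma killing_symm : (β_ g g).hom ≫ killing g = killing g := by
  have h := isDualPair_form (g := g)
  have H (X : C) : swapLeft g g X ≫ formLeft (killing g) X = formLeft (killing g) X := by
    rw [h.formLeft_killing, ← h.formLeft_casimirLeft, ← reassoc_of% casimirLeft_swapLeft,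
      swapLeft_formLeft _ h.symm, h.formLeft_casimirLeft]
  refine form_ext ?_
  rw [← H]
  simp only [swapLeft, formLeft]; monoidal

/-- Here self-adjointness is combined with the fact that the Casimir operator of `B` commutes with
the adjoint action. -/
lemma killing_invariant (X : C) :
    bracketLeft LieObj.bracket (g ⊗ X) ≫ formLeft (killing g) X =
      g ◁ bracketLeft LieObj.bracket X ≫ formLeft (killing g) X := by
  have h := isDualPair_form (g := g)
  rw [h.formLeft_killing, ← h.formLeft_casimirLeft,
    ← reassoc_of% casimirLeft_bracketLeft_of_invariant _ h.copairing_invariant, h.invariant,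
    reassoc_of% casimirLeft_naturality]

lemma formLeft_levelForm (k : ℂ) (X : C) : formLeft (levelForm g k) X =
    k • formLeft Quadratic.form X + (1 / 2 : ℂ) • formLeft (killing g) X := by
  simp only [formLeft, levelForm, MonoidalPreadditive.add_whiskerRight,
    MonoidalLinear.smul_whiskerRight, Preadditive.add_comp, Preadditive.comp_add,
    Linear.smul_comp, Linear.comp_smul]

lemma isDualPair_levelForm {k : ℂ} (hk : IsNonCritical g k) :
    IsDualPair (levelForm g k) (copairing (levelForm g k) hk) := by
  refine .of_nondegenerate hk ?_ fun X => ?_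
  · simp only [levelForm, Preadditive.comp_add, Linear.comp_smul, Quadratic.symm, killing_symm]
  · simp only [formLeft_levelForm, Preadditive.comp_add, Linear.comp_smul, killing_invariant,
      isDualPair_form.invariant]

/-- `k B(eⁱ, x) eᵢ + (1/2) [eᵢ, [eⁱ, x]] = x`. -/
lemma copairing_form_add_casimir {k : ℂ} (hk : IsNonCritical g k) (X : C) :
    k • copairingLeft (copairing (levelForm g k) hk) (g ⊗ X) ≫ g ◁ formLeft Quadratic.form X +
      (1 / 2 : ℂ) • casimirLeft (copairing (levelForm g k) hk) X = 𝟙 _ := by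
  have h := isDualPair_levelForm hk
  -- Since `Kil(x, y) = B_k(x, Cas y)`, the zigzag for `B_k` gives `Cas x = ∑ Kil(eᵃ, x) eₐ`. The
  -- claim is then the zigzag `∑ B_k(eᵃ, x) eₐ = x` with `B_k` expanded.
  have e : casimirLeft (copairing (levelForm g k) hk) X =
      copairingLeft (copairing (levelForm g k) hk) (g ⊗ X) ≫ g ◁ formLeft (killing g) X := by
    rw [h.formLeft_killing, MonoidalCategory.whiskerLeft_comp,
      reassoc_of% copairingLeft_naturality, h.form_copairing, Category.comp_id]
  rw [e, ← h.form_copairing, formLeft_levelForm]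
  simp only [MonoidalPreadditive.whiskerLeft_add, MonoidalLinear.whiskerLeft_smul,
    Preadditive.comp_add, Linear.comp_smul]

/-- A symmetric tensor contracted with a skew bracket equals its own negative. -/
lemma IsDualPair.copairingLeft_bracketLeft {b : g ⊗ g ⟶ 𝟙_ C} {t : 𝟙_ C ⟶ g ⊗ g}
    (h : IsDualPair b t) (X : C) :
    copairingLeft t X ≫ bracketLeft LieObj.bracket X = 0 := by
  have e := reassoc_of% h.copairingLeft_swapLeft X
  have := e (bracketLeft LieObj.bracket X)
  rw [swapLeft_bracketLeft, Preadditive.comp_neg] at this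
  linear_combination (norm := module) (-(1 / 2) : ℂ) • this

end Casimir

/-! ### Tail sums over the integers and their telescoping identities -/

section TailSums

variable {V W : Type*} [AddCommGroup V] [Module ℂ V] [AddCommGroup W] [Module ℂ W]

/-- The sum `∑_{j ≥ p} f j`, for a function `f` which vanishes at large integers. -/
def tailSum (f : ℤ → V) (p : ℤ) : V := ∑ᶠ j : ℤ, if p ≤ j then f j else 0

lemma tailSum_support_finite {f : ℤ → V} (hf : ∀ᶠ j in Filter.atTop, f j = 0) (p : ℤ) :
    (Function.support fun j : ℤ => if p ≤ j then f j else 0).Finite := by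
  obtain ⟨N, hN⟩ := Filter.eventually_atTop.1 hf
  refine (Set.finite_Icc p N).subset fun j hj => ?_
  rw [Function.mem_support, ne_eq, ite_eq_right_iff, Classical.not_imp] at hj
  exact ⟨hj.1, le_of_not_ge fun h => hj.2 (hN j h)⟩

lemma tailSum_add {f h : ℤ → V} (hf : ∀ᶠ j in Filter.atTop, f j = 0)
    (hh : ∀ᶠ j in Filter.atTop, h j = 0) (p : ℤ) :
    tailSum (fun j => f j + h j) p = tailSum f p + tailSum h p := by
  rw [tailSum, tailSum, tailSum, ← finsum_add_distrib (tailSum_support_finite hf p)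
    (tailSum_support_finite hh p)]
  exact finsum_congr fun j => by split_ifs <;> simp

lemma map_tailSum (φ : V →ₗ[ℂ] W) {f : ℤ → V} (hf : ∀ᶠ j in Filter.atTop, f j = 0) (p : ℤ) :
    φ (tailSum f p) = tailSum (fun j => φ (f j)) p := by
  rw [tailSum, map_finsum φ (tailSum_support_finite hf p)]
  exact finsum_congr fun j => by split_ifs <;> simp

lemma tailSum_smul (a : ℂ) {f : ℤ → V} (hf : ∀ᶠ j in Filter.atTop, f j = 0) (p : ℤ) :
    tailSum (fun j => a • f j) p = a • tailSum f p :=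
  (map_tailSum (a • LinearMap.id) hf p).symm

lemma tailSum_sub {f h : ℤ → V} (hf : ∀ᶠ j in Filter.atTop, f j = 0)
    (hh : ∀ᶠ j in Filter.atTop, h j = 0) (p : ℤ) :
    tailSum (fun j => f j - h j) p = tailSum f p - tailSum h p := by
  have := tailSum_add hf (h := fun j => (-1 : ℂ) • h j) (hh.mono fun j hj => by simp [hj]) p
  rw [tailSum_smul _ hh] at this
  simpa [sub_eq_add_neg] using this

lemma tailSum_shift (f : ℤ → V) (m p : ℤ) :
    tailSum (fun j => f (j + m)) p = tailSum f (p + m) := by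
  refine (finsum_congr fun j => ?_).trans (finsum_comp_equiv (Equiv.addRight m)
    (f := fun j => if p + m ≤ j then f j else 0))
  simp

lemma tailSum_ite (a p : ℤ) (y : V) :
    tailSum (fun j => if j = a then y else 0) p = if p ≤ a then y else 0 := by
  rw [tailSum, finsum_eq_single _ a]
  · simp
  · intro j hj; simp [hj]

lemma tailSum_succ {f : ℤ → V} (hf : ∀ᶠ j in Filter.atTop, f j = 0) (p : ℤ) :
    tailSum f p = f p + tailSum f (p + 1) := by
  have h₁ : tailSum f p = tailSum (fun j => (if j = p then f p else 0) +
      (if p + 1 ≤ j then f j else 0)) p := by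
    refine finsum_congr fun j => ?_
    rcases lt_trichotomy j p with h | rfl | h
    · rw [if_neg (by omega), if_neg (by omega)]
    · simp
    · simp [h.le, h.ne', Int.add_one_le_iff.2 h]
  rw [h₁, tailSum_add, tailSum_ite, if_pos le_rfl]
  · congr 1
    refine finsum_congr fun j => ?_
    by_cases h : p + 1 ≤ j
    · rw [if_pos (by omega)]
    · simp [h]
  · filter_upwards [Filter.eventually_gt_atTop p] with j hj
    rw [if_neg (by omega)]
  · filter_upwards [hf] with j hj
    simp [hj]

lemma tailSum_reflect (f : ℤ → V) (n p : ℤ) :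
    (∑ᶠ i : ℤ, if i < p then f (n - i) else 0) = tailSum f (n - p + 1) := by
  refine (finsum_congr fun j => ?_).trans (finsum_comp_equiv (Equiv.subLeft n)
    (f := fun j => if n - p + 1 ≤ j then f j else 0))
  simp only [Equiv.subLeft_apply]
  congr 1
  exact propext ⟨fun h => by omega, fun h => by omega⟩

/-- Handles window lengths `m` of either sign at once: for negative `m` a difference of two tails is
minus a finite sum. -/
lemma eq_of_int_differences {F G : ℤ → V} (h₀ : F 0 = G 0)
    (h : ∀ m, F (m + 1) - F m = G (m + 1) - G m) (m : ℤ) : F m = G m := by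
  induction m using Int.induction_on with
  | zero => exact h₀
  | succ i hi => linear_combination (norm := module) h i + hi
  | pred i hi =>
    have := h (-i - 1)
    rw [sub_add_cancel] at this
    linear_combination (norm := module) hi - this

/-- For `m ≥ 0` the two differences are sums over `M - m < j ≤ M` and `0 ≤ j < m`. The reflection `j
↦ M - j` matches them into `m` pairs, each with sum `κ`. -/
lemma tailSum_symmetric {f : ℤ → V} (hf : ∀ᶠ j in Filter.atTop, f j = 0) {M : ℤ} {κ : V}
    (h : ∀ j, f (M - j) + f j = κ) (m : ℤ) :
    tailSum f (M - m + 1) - tailSum f (M + 1) + (tailSum f 0 - tailSum f m) = (m : ℂ) • κ := by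
  refine eq_of_int_differences (F := fun m => tailSum f (M - m + 1) - tailSum f (M + 1) +
    (tailSum f 0 - tailSum f m)) (G := fun m : ℤ => (m : ℂ) • κ) (by simp) (fun m => ?_) m
  have h₁ := tailSum_succ hf (M - m)
  have h₂ := tailSum_succ hf m
  have h₃ : M - (m + 1) + 1 = M - m := by ring
  simp only [h₃, h₁, h₂, Int.cast_add, Int.cast_one]
  linear_combination (norm := module) h m

lemma tailSum_antisymmetric {f : ℤ → V} (hf : ∀ᶠ j in Filter.atTop, f j = 0) {M : ℤ} {κ : V}
    (h : ∀ j : ℤ, f (M - j) - f j = (j : ℂ) • κ) (m : ℤ) :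
    tailSum f (M - m + 1) - tailSum f (M + 1) - (tailSum f 0 - tailSum f m) =
      (m * (m - 1) / 2 : ℂ) • κ := by
  refine eq_of_int_differences (F := fun m => tailSum f (M - m + 1) - tailSum f (M + 1) -
    (tailSum f 0 - tailSum f m)) (G := fun m : ℤ => (m * (m - 1) / 2 : ℂ) • κ) (by simp)
    (fun m => ?_) m
  have h₁ := tailSum_succ hf (M - m)
  have h₂ := tailSum_succ hf m
  have h₃ : M - (m + 1) + 1 = M - m := by ring
  simp only [h₃, h₁, h₂, Int.cast_add, Int.cast_one]
  linear_combination (norm := module) h m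

/-- The windows of `tailSum_symmetric` carry the weights `j + m - M` and `j - m`. Reflecting the
first window leaves `∑ (m - j) (f (M - j) - f j) = ∑ (m - j) j κ` over `0 ≤ j < m`, the source of
the cubic. Its increment in `m` is the quadratic of `tailSum_antisymmetric` plus `m κ`. -/
lemma tailSum_cubic {f : ℤ → V} (hf : ∀ᶠ j in Filter.atTop, f j = 0) {M : ℤ} {κ : V}
    (h : ∀ j : ℤ, f (M - j) - f j = (j : ℂ) • κ) (m : ℤ) :
    (tailSum (fun j => (j : ℂ) • f j) (M - m + 1) - tailSum (fun j => (j : ℂ) • f j) (M + 1) +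
      ((m : ℂ) - M) • (tailSum f (M - m + 1) - tailSum f (M + 1))) +
    (tailSum (fun j => (j : ℂ) • f j) 0 - tailSum (fun j => (j : ℂ) • f j) m -
      (m : ℂ) • (tailSum f 0 - tailSum f m)) = (((m : ℂ) ^ 3 - m) / 6) • κ := by
  have hf' : ∀ᶠ j : ℤ in Filter.atTop, (j : ℂ) • f j = 0 := hf.mono fun j hj => by simp [hj]
  refine eq_of_int_differences (F := fun m : ℤ =>
    (tailSum (fun j => (j : ℂ) • f j) (M - m + 1) - tailSum (fun j => (j : ℂ) • f j) (M + 1) +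
      ((m : ℂ) - M) • (tailSum f (M - m + 1) - tailSum f (M + 1))) +
    (tailSum (fun j => (j : ℂ) • f j) 0 - tailSum (fun j => (j : ℂ) • f j) m -
      (m : ℂ) • (tailSum f 0 - tailSum f m)))
    (G := fun m : ℤ => (((m : ℂ) ^ 3 - m) / 6) • κ) (by simp) (fun m => ?_) m
  have h₁ := tailSum_succ hf (M - m)
  have h₂ := tailSum_succ hf m
  have h₁' := tailSum_succ hf' (M - m)
  have h₂' := tailSum_succ hf' m
  have h₃ : M - (m + 1) + 1 = M - m := by ring
  have h₄ := tailSum_antisymmetric hf h m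
  rw [h₂] at h₄
  simp only [h₃, h₁, h₂, h₁', h₂', Int.cast_add, Int.cast_sub, Int.cast_one]
  linear_combination (norm := module) h₄ + h m

end TailSums

/-! ### From vanishing on subobjects to vanishing on every element -/

section Admissible

variable {C : Type u} [Category.{v} C] [Abelian C] [Linear ℂ C]

/-- Two morphisms into `X` which agree on an element of an ind-object agree after pushing that
element forward along some `h`. -/
lemma IndObj.exists_eq_of_res_eq (M : IndObj C) {X Z : C} (x : M.El X) (f₁ f₂ : Z ⟶ X)
    (h : M.res f₁ x = M.res f₂ x) :
    ∃ (Y : C) (y : M.El Y) (p : X ⟶ Y), M.res p y = x ∧ f₁ ≫ p = f₂ ≫ p := by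
  let A := M.toFunctor ⋙ forget (ModuleCat.{v} ℂ)
  have := M.isInd.isFiltered
  let a : CostructuredArrow yoneda A := CostructuredArrow.mk (yonedaEquiv.symm x : yoneda.obj X ⟶ A)
  let c : CostructuredArrow yoneda A :=
    CostructuredArrow.mk (yonedaEquiv.symm (M.res f₁ x) : yoneda.obj Z ⟶ A)
  have e (f : Z ⟶ X) : yoneda.map f ≫ (yonedaEquiv.symm x : yoneda.obj X ⟶ A) =
      (yonedaEquiv.symm (M.res f x) : yoneda.obj Z ⟶ A) :=
    yonedaEquiv_symm_naturality_left f A x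
  let φ₁ : c ⟶ a := CostructuredArrow.homMk f₁ (e f₁)
  let φ₂ : c ⟶ a := CostructuredArrow.homMk f₂ ((e f₂).trans (by rw [← h]; rfl))
  refine ⟨(IsFiltered.coeq φ₁ φ₂).left, yonedaEquiv (IsFiltered.coeq φ₁ φ₂).hom,
    (IsFiltered.coeqHom φ₁ φ₂).left, ?_, ?_⟩
  · have w := CostructuredArrow.w (IsFiltered.coeqHom φ₁ φ₂)
    have w' := congrArg yonedaEquiv w
    rw [← yonedaEquiv_naturality] at w'
    exact w'.trans ((yonedaEquiv : (yoneda.obj X ⟶ A) ≃ _).apply_symm_apply x)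
  · exact congrArg CommaMorphism.left (IsFiltered.coeq_condition φ₁ φ₂)

/-- Every element of an ind-object with noetherian source factors through a subobject. -/
lemma IndObj.exists_isSubobject (M : IndObj C) {X : C} [IsNoetherianObject X] (x : M.El X) :
    ∃ (Y : C) (y : M.El Y) (p : X ⟶ Y), M.IsSubobject y ∧ M.res p y = x := by
  -- Among all factorizations `x = M.res p y`, choose one whose kernel `ker p` is maximal; the image
  -- of `p` is then a subobject of `M`.
  let S : Set (Subobject X) :=
    {K | ∃ (Y : C) (y : M.El Y) (p : X ⟶ Y), M.res p y = x ∧ kernelSubobject p = K}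
  obtain ⟨K, ⟨Y, y, p, rfl, rfl⟩, hK⟩ := (wellFounded_gt (α := Subobject X)).has_min S
    ⟨_, X, x, 𝟙 X, M.res_id x, rfl⟩
  refine ⟨image p, M.res (image.ι p) y, factorThruImage p, fun Z f₁ f₂ h => ?_, by simp⟩
  obtain ⟨Y', y', q, hq, hf⟩ := M.exists_eq_of_res_eq _ f₁ f₂ h
  have hle : kernelSubobject p ≤ kernelSubobject (factorThruImage p ≫ q) := by
    refine le_kernelSubobject _ _ ?_
    have : (kernelSubobject p).arrow ≫ factorThruImage p = 0 := by
      rw [← cancel_mono (image.ι p)]; simp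
    rw [reassoc_of% this, zero_comp]
  have heq : kernelSubobject (factorThruImage p ≫ q) = kernelSubobject p :=
    (hle.eq_of_not_lt (hK _ ⟨Y', y', _, by rw [← res_res, hq, res_res, image.fac], rfl⟩)).symm
  have hu : (f₁ - f₂) ≫ q = 0 := by rw [Preadditive.sub_comp, hf, sub_self]
  -- By maximality, `q` enlarges no kernel. Pulling `f₁ - f₂` back along the epimorphism `X ⟶ image
  -- p` lifts it to `X`, where it lands in `ker p`; the projection `pullback.fst` is again an
  -- epimorphism, so `f₁ = f₂`.
  have hfac : (kernelSubobject (factorThruImage p ≫ q)).Factors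
      (pullback.snd (f₁ - f₂) (factorThruImage p)) :=
    (kernelSubobject_factors_iff _ _).2 (by
      rw [← Category.assoc, ← pullback.condition, Category.assoc, hu, comp_zero])
  rw [heq, kernelSubobject_factors_iff] at hfac
  have h₀ : pullback.fst (f₁ - f₂) (factorThruImage p) ≫ (f₁ - f₂) = 0 := by
    rw [← cancel_mono (image.ι p), pullback.condition, Category.assoc, image.fac, hfac, zero_comp]
  exact sub_eq_zero.1 ((cancel_epi (pullback.fst (f₁ - f₂) (factorThruImage p))).1
    (h₀.trans comp_zero.symm))

variable [MonoidalCategory C] [SymmetricCategory C] [RigidCategory C] [MonoidalPreadditive C]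
  [MonoidalLinear ℂ C] {g : C} [LieObj g] [Quadratic g] {M : IndObj C}

namespace LieMod

lemma zAct_res (ρ : LieMod (affine g) M) (n : ℤ) {X Y : C} (f : X ⟶ Y) (m : M.El Y) :
    ρ.zAct n (M.res f m) = M.res (g ◁ f) (ρ.zAct n m) :=
  ρ.act.res_right f _ m

lemma IsAdmissible.eventually_zAct_eq_zero {ρ : LieMod (affine g) M} (h : ρ.IsAdmissible)
    {X : C} [IsNoetherianObject X] (m : M.El X) : ∀ᶠ n in Filter.atTop, ρ.zAct n m = 0 := by
  obtain ⟨Y, y, p, hy, rfl⟩ := M.exists_isSubobject m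
  obtain ⟨N, hN⟩ := h Y y hy
  filter_upwards [Filter.eventually_ge_atTop (N : ℤ)] with n hn
  rw [zAct_res, hN n hn, map_zero]

end LieMod

end Admissible

/-! ### Commutation relations of the quadratic elements `∑ (eₐ zⁱ)(eᵃ zʲ)` -/

section Sugawara

variable {C : Type u} [Category.{v} C] [Abelian C] [Linear ℂ C] [MonoidalCategory C]
  [SymmetricCategory C] [RigidCategory C] [MonoidalPreadditive C] [MonoidalLinear ℂ C]
  {g : C} [LieObj g] [Quadratic g] {M : IndObj C}

namespace LieMod

variable (ρ : LieMod (affine g) M)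

/-- The action of `ĝ`, as a bilinear operation on the coproduct underlying `ĝ`. -/
def affAct : Bilin (coprod (affObj g)) M M := ρ.act

lemma affAct_affZ (n : ℤ) {X Y : C} (f : Y ⟶ g) (m : M.El X) :
    ρ.affAct.app (affZ g n f) m = M.res (f ▷ X) (ρ.zAct n m) := by
  change _ = M.res (f ▷ X) (ρ.affAct.app (affZ g n (𝟙 g)) m)
  rw [← Bilin.res_left, res_affZ, Category.comp_id]

lemma HasLevel.affAct_affK {ρ : LieMod (affine g) M} {k : ℂ} (hlev : ρ.HasLevel k) {X Y : C}
    (f : Y ⟶ 𝟙_ C) (m : M.El X) :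
    ρ.affAct.app (affK g f) m = k • M.res (f ▷ X ≫ (λ_ X).hom) m := by
  have h : ρ.affAct.app (affK g (𝟙 (𝟙_ C))) m = k • M.res (λ_ X).hom m := hlev X m
  rw [← IndObj.res_res, ← map_smul, ← h, ← Bilin.res_left, res_affK, Category.comp_id]

variable {ρ} {k : ℂ}

lemma HasLevel.zAct_zAct (hlev : ρ.HasLevel k) (i j : ℤ) {X : C} (m : M.El X) :
    ρ.zAct i (ρ.zAct j m) = M.res (bracketLeft LieObj.bracket X) (ρ.zAct (i + j) m) +
      (affCocycle i j * k) • M.res (formLeft Quadratic.form X) m +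
      M.res (swapLeft g g X) (ρ.zAct j (ρ.zAct i m)) := by
  have h : M.res (α_ g g X).inv
      (ρ.affAct.app ((affBilin g).app (affZ g i (𝟙 g)) (affZ g j (𝟙 g))) m) =
      ρ.zAct i (ρ.zAct j m) - M.res (swapLeft g g X) (ρ.zAct j (ρ.zAct i m)) :=
    ρ.lie (affZ g i (𝟙 g)) (affZ g j (𝟙 g)) m
  rw [affBilin_zz, map_add, LinearMap.add_apply, affAct_affZ, hlev.affAct_affK, map_add, map_smul,
    IndObj.res_res, IndObj.res_res, MonoidalLinear.smul_whiskerRight, Linear.smul_comp,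
    Linear.comp_smul, IndObj.smul_res, id_tensorHom_id, Category.id_comp, Category.id_comp] at h
  rw [← sub_eq_iff_eq_add, ← h, mul_comm, mul_smul]
  rfl

/-- The commutator relation of the operators `eᵢ z^i eⁱ z^j`. -/
lemma HasLevel.quadAct_swap (hlev : ρ.HasLevel k) {b : g ⊗ g ⟶ 𝟙_ C} {t : 𝟙_ C ⟶ g ⊗ g}
    (h : IsDualPair b t) {d : ℂ} (hd : t ≫ Quadratic.form = d • 𝟙 (𝟙_ C)) (i j : ℤ) {X : C}
    (m : M.El X) :
    ρ.quadAct t i j m = ρ.quadAct t j i m + (affCocycle i j * (k * d)) • m := by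
  have e : copairingLeft t X ≫ formLeft Quadratic.form X = d • 𝟙 X := by
    simp only [copairingLeft, formLeft, Category.assoc, Iso.hom_inv_id_assoc]
    rw [← comp_whiskerRight_assoc, hd]
    simp [MonoidalLinear.smul_whiskerRight]
  change M.res (copairingLeft t X) (ρ.zAct i (ρ.zAct j m)) =
    M.res (copairingLeft t X) (ρ.zAct j (ρ.zAct i m)) + _
  rw [hlev.zAct_zAct, map_add, map_add, map_smul, IndObj.res_res, IndObj.res_res, IndObj.res_res,
    h.copairingLeft_bracketLeft, h.copairingLeft_swapLeft, e, IndObj.smul_res, IndObj.res_id]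
  have z : M.res (0 : X ⟶ g ⊗ X) (ρ.zAct (i + j) m) = 0 := by
    simpa using M.smul_res 0 (0 : X ⟶ g ⊗ X) (ρ.zAct (i + j) m)
  rw [z]
  module

/-- The operator `x ↦ (eᵢ z^i) ([eⁱ, x] z^j)`. -/
def bracketAct (ρ : LieMod (affine g) M) (t : 𝟙_ C ⟶ g ⊗ g) (i j : ℤ) {X : C} :
    M.El X →ₗ[ℂ] M.El (g ⊗ X) :=
  M.res (copairingLeft t (g ⊗ X) ≫ g ◁ bracketLeft LieObj.bracket X) ∘ₗ ρ.zAct i ∘ₗ ρ.zAct j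

/-- The operator `x ↦ B(eⁱ, x) eᵢ zⁿ`. -/
def formAct (ρ : LieMod (affine g) M) (t : 𝟙_ C ⟶ g ⊗ g) (n : ℤ) {X : C} :
    M.El X →ₗ[ℂ] M.El (g ⊗ X) :=
  M.res (copairingLeft t (g ⊗ X) ≫ g ◁ formLeft Quadratic.form X) ∘ₗ ρ.zAct n

/-- Exchanging the two modes uses the antisymmetry of `∑ eₐ ⊗ [eᵃ, x]`, so the reordered terms
cancel in the sum and the bracket leaves `Cas x`. No cocycle term survives, because `B(eₐ, [eᵃ, x])
= B([eₐ, eᵃ], x)` sums to zero. -/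
lemma HasLevel.bracketAct_add (hlev : ρ.HasLevel k) {b : g ⊗ g ⟶ 𝟙_ C} {t : 𝟙_ C ⟶ g ⊗ g}
    (h : IsDualPair b t) (i j : ℤ) {X : C} (m : M.El X) :
    ρ.bracketAct t i j m + ρ.bracketAct t j i m =
      M.res (casimirLeft t X) (ρ.zAct (i + j) m) := by
  have e : copairingLeft t (g ⊗ X) ≫ g ◁ bracketLeft LieObj.bracket X ≫
      formLeft Quadratic.form X = 0 := by
    rw [← isDualPair_form.invariant, reassoc_of% h.copairingLeft_bracketLeft, zero_comp]
  have z : M.res (0 : g ⊗ X ⟶ X) m = 0 := by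
    simpa using M.smul_res 0 (0 : g ⊗ X ⟶ X) m
  simp only [bracketAct, LinearMap.comp_apply]
  rw [hlev.zAct_zAct i j, map_add, map_add, map_smul, IndObj.res_res, IndObj.res_res,
    IndObj.res_res, h.copairing_bracketLeft_swapLeft, Category.assoc, Category.assoc, e, z]
  have n (f : g ⊗ X ⟶ g ⊗ (g ⊗ X)) (x : M.El (g ⊗ (g ⊗ X))) : M.res (-f) x = - M.res f x := by
    simpa using M.smul_res (-1) f x
  rw [n]
  simp [casimirLeft]

/-- Move `x zⁿ` leftwards past the two factors in turn; each passage yields a bracket term and a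
cocycle term. Invariance rewrites `[eₐ, x] ⊗ eᵃ` as `-eₐ ⊗ [eᵃ, x]`, so both bracket terms are
values of `bracketAct` with opposite signs, ready to telescope. -/
lemma HasLevel.quadAct_zAct (hlev : ρ.HasLevel k) {b : g ⊗ g ⟶ 𝟙_ C} {t : 𝟙_ C ⟶ g ⊗ g}
    (h : IsDualPair b t) (i j n : ℤ) {X : C} (m : M.El X) :
    ρ.quadAct t i j (ρ.zAct n m) = ρ.zAct n (ρ.quadAct t i j m) +
      ρ.bracketAct t i (j + n) m - ρ.bracketAct t (i + n) j m +
      (affCocycle j n * k) • ρ.formAct t i m + (affCocycle i n * k) • ρ.formAct t j m := by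
  have neg (f : g ⊗ X ⟶ g ⊗ (g ⊗ X)) (x : M.El (g ⊗ (g ⊗ X))) : M.res (-f) x = - M.res f x := by
    simpa using M.smul_res (-1) f x
  change M.res (copairingLeft t (g ⊗ X)) (ρ.zAct i (ρ.zAct j (ρ.zAct n m))) =
    ρ.zAct n (M.res (copairingLeft t X) (ρ.zAct i (ρ.zAct j m))) + _ - _ + _ + _
  simp only [bracketAct, formAct, LinearMap.comp_apply]
  rw [hlev.zAct_zAct j n]
  simp only [map_add, map_smul, zAct_res, IndObj.res_res]
  rw [hlev.zAct_zAct i n]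
  simp only [map_add, map_smul, zAct_res, IndObj.res_res, Category.assoc]
  rw [h.copairing_swapLeft_bracketLeft, h.copairing_formLeft_swap, neg,
    ← whiskerLeft_copairingLeft]
  module

end LieMod

end Sugawara

/-! ### The Sugawara operators and their commutators -/

section SugawaraOperators

variable {C : Type u} [Category.{v} C] [Abelian C] [Linear ℂ C] [MonoidalCategory C]
  [SymmetricCategory C] [RigidCategory C] [MonoidalPreadditive C] [MonoidalLinear ℂ C]
  {g : C} [LieObj g] [Quadratic g] {M : IndObj C}

namespace LieMod

/-- Every element of `M` is annihilated by `g zⁿ` for large `n`. -/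
def IsSmooth (ρ : LieMod (affine g) M) : Prop :=
  ∀ {X : C} (m : M.El X), ∀ᶠ n in Filter.atTop, ρ.zAct n m = 0

variable {ρ : LieMod (affine g) M} (hρ : ρ.IsSmooth) (t : 𝟙_ C ⟶ g ⊗ g)

lemma IsSmooth.quadAct_eventually (hρ : ρ.IsSmooth) (t : 𝟙_ C ⟶ g ⊗ g) (i : ℤ → ℤ) {X : C}
    (m : M.El X) : ∀ᶠ j in Filter.atTop, ρ.quadAct t (i j) j m = 0 := by
  filter_upwards [hρ m] with j hj
  simp [quadAct, hj]

lemma IsSmooth.bracketAct_eventually (hρ : ρ.IsSmooth) (t : 𝟙_ C ⟶ g ⊗ g) (i : ℤ → ℤ) {X : C}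
    (m : M.El X) : ∀ᶠ j in Filter.atTop, ρ.bracketAct t (i j) j m = 0 := by
  filter_upwards [hρ m] with j hj
  simp [bracketAct, hj]

lemma quadAct_res (ρ : LieMod (affine g) M) (i j : ℤ) {X Y : C} (f : X ⟶ Y) (m : M.El Y) :
    ρ.quadAct t i j (M.res f m) = M.res f (ρ.quadAct t i j m) := by
  change M.res (copairingLeft t X) (ρ.zAct i (ρ.zAct j (M.res f m))) =
    M.res f (M.res (copairingLeft t Y) (ρ.zAct i (ρ.zAct j m)))
  rw [zAct_res, zAct_res, IndObj.res_res, IndObj.res_res, copairingLeft_naturality]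

/-- The Sugawara operator
`Lₙ = (1/2) (∑_{j > n} eᵢ zⁿ⁻ʲ eⁱ zʲ + ∑_{j ≥ 0} eᵢ zⁿ⁻ʲ eⁱ zʲ)`. -/
def sugawaraOp (n : ℤ) {X : C} : M.El X →ₗ[ℂ] M.El X where
  toFun m := (1 / 2 : ℂ) • (tailSum (fun j => ρ.quadAct t (n - j) j m) (n + 1) +
    tailSum (fun j => ρ.quadAct t (n - j) j m) 0)
  map_add' x y := by
    have hx := hρ.quadAct_eventually t (n - ·) x
    have hy := hρ.quadAct_eventually t (n - ·) y
    simp only [map_add, tailSum_add hx hy]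
    module
  map_smul' a x := by
    have hx := hρ.quadAct_eventually t (n - ·) x
    simp only [map_smul, tailSum_smul a hx, RingHom.id_apply]
    module

lemma sugawaraOp_apply (n : ℤ) {X : C} (m : M.El X) : sugawaraOp hρ t n m =
    (1 / 2 : ℂ) • (tailSum (fun j => ρ.quadAct t (n - j) j m) (n + 1) +
      tailSum (fun j => ρ.quadAct t (n - j) j m) 0) := rfl

lemma sugawaraOp_res (n : ℤ) {X Y : C} (f : X ⟶ Y) (m : M.El Y) :
    sugawaraOp hρ t n (M.res f m) = M.res f (sugawaraOp hρ t n m) := by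
  have h := hρ.quadAct_eventually t (n - ·) m
  simp only [sugawaraOp_apply, quadAct_res, map_smul, map_add, map_tailSum _ h]

variable {t} {k : ℂ} {b : g ⊗ g ⟶ 𝟙_ C}

lemma sugawaraOp_zAct (hlev : ρ.HasLevel k) (h : IsDualPair b t)
    (hc : ∀ X : C, k • copairingLeft t (g ⊗ X) ≫ g ◁ formLeft Quadratic.form X +
      (1 / 2 : ℂ) • casimirLeft t X = 𝟙 _) (n p : ℤ) {X : C} (m : M.El X) :
    sugawaraOp hρ t n (ρ.zAct p m) =
      ρ.zAct p (sugawaraOp hρ t n m) - (p : ℂ) • ρ.zAct (n + p) m := by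
  set Q : ℤ → M.El X := fun j => ρ.quadAct t (n - j) j m with hQ
  set f : ℤ → M.El (g ⊗ X) := fun j => ρ.bracketAct t (n + p - j) j m with hf
  -- The common value of the two cocycle terms: each is nonzero for a single `j`, where the mode
  -- paired with `p` is `-p`.
  set y : M.El (g ⊗ X) := -(p * k : ℂ) • ρ.formAct t (n + p) m with hy
  have eQ : ∀ᶠ j in Filter.atTop, Q j = 0 := hρ.quadAct_eventually t (n - ·) m
  have ef : ∀ᶠ j in Filter.atTop, f j = 0 := hρ.bracketAct_eventually t (n + p - ·) m
  have ef' : ∀ᶠ j in Filter.atTop, f (j + p) = 0 :=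
    (Filter.tendsto_atTop_add_const_right _ p Filter.tendsto_id).eventually ef
  have ezQ : ∀ᶠ j in Filter.atTop, ρ.zAct p (Q j) = 0 := eQ.mono fun j hj => by simp [hj]
  have ei (a : ℤ) : ∀ᶠ j in Filter.atTop, (if j = a then y else 0) = 0 := by
    filter_upwards [Filter.eventually_gt_atTop a] with j hj
    rw [if_neg hj.ne']
  have pointwise (j : ℤ) : ρ.quadAct t (n - j) j (ρ.zAct p m) =
      ρ.zAct p (Q j) + (f (j + p) - f j) +
        ((if j = -p then y else 0) + (if j = n + p then y else 0)) := by
    have e₁ : n + p - (j + p) = n - j := by ring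
    have e₂ : n + p - j = n - j + p := by ring
    have e₃ : (affCocycle j p * k) • ρ.formAct t (n - j) m = if j = -p then y else 0 := by
      unfold affCocycle
      by_cases hj : j = -p
      · subst hj; simp [hy]
      · rw [if_neg (by omega), if_neg hj]; simp
    have e₄ : (affCocycle (n - j) p * k) • ρ.formAct t j m = if j = n + p then y else 0 := by
      unfold affCocycle
      by_cases hj : j = n + p
      · subst hj; simp [hy]
      · rw [if_neg (by omega), if_neg hj]; simp
    rw [hlev.quadAct_zAct h, e₃, e₄]
    simp only [hQ, hf, e₁, e₂]
    abel
  have sum (q : ℤ) : tailSum (fun j => ρ.quadAct t (n - j) j (ρ.zAct p m)) q =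
      ρ.zAct p (tailSum Q q) + (tailSum f (q + p) - tailSum f q) +
        ((if q ≤ -p then y else 0) + (if q ≤ n + p then y else 0)) := by
    simp only [pointwise]
    rw [tailSum_add, tailSum_add ezQ, tailSum_sub ef' ef, tailSum_add (ei _) (ei _), tailSum_ite,
      tailSum_ite, tailSum_shift, map_tailSum _ eQ]
    · filter_upwards [ef', ef] with j h₁ h₂
      rw [h₁, h₂, sub_zero]
    · filter_upwards [ezQ, ef', ef] with j h₁ h₂ h₃
      rw [h₁, h₂, h₃, sub_zero, add_zero]
    · filter_upwards [ei (-p), ei (n + p)] with j h₁ h₂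
      rw [h₁, h₂, add_zero]
  have sym : ∀ j, f (n + p - j) + f j = M.res (casimirLeft t X) (ρ.zAct (n + p) m) := by
    intro j
    have := hlev.bracketAct_add h (n + p - j) j m
    rw [sub_add_cancel] at this
    rw [← this, add_comm]
    simp only [hf, sub_sub_cancel]
  have S := tailSum_symmetric ef sym p
  rw [show n + p - p + 1 = n + 1 by ring] at S
  -- Exactly two of the four conditions hold: `n + 1 ≤ -p` is the negation of `0 ≤ n + p`, and `n +
  -- 1 ≤ n + p` that of `0 ≤ -p`.
  have I : ((if n + 1 ≤ -p then y else 0) + (if n + 1 ≤ n + p then y else 0)) +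
      ((if 0 ≤ -p then y else 0) + (if 0 ≤ n + p then y else 0)) = (2 : ℂ) • y := by
    rcases le_or_gt 0 (n + p) with h₁ | h₁ <;> rcases le_or_gt p 0 with h₂ | h₂
    · rw [if_neg (by omega), if_neg (by omega), if_pos (by omega), if_pos (by omega)]; module
    · rw [if_neg (by omega), if_pos (by omega), if_neg (by omega), if_pos (by omega)]; module
    · rw [if_pos (by omega), if_neg (by omega), if_pos (by omega), if_neg (by omega)]; module
    · rw [if_pos (by omega), if_pos (by omega), if_neg (by omega), if_neg (by omega)]; module
  have D : ρ.zAct (n + p) m = k • ρ.formAct t (n + p) m +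
      (1 / 2 : ℂ) • M.res (casimirLeft t X) (ρ.zAct (n + p) m) := by
    have := M.res_id (ρ.zAct (n + p) m)
    rw [← hc X, IndObj.add_res, IndObj.smul_res, IndObj.smul_res] at this
    exact this.symm
  rw [sugawaraOp_apply, sugawaraOp_apply, sum, sum, map_smul, map_add,
    show n + 1 + p = n + p + 1 by ring, zero_add]
  linear_combination (norm := skip) (1 / 2 : ℂ) • I - (1 / 2 : ℂ) • S + (p : ℂ) • D
  simp only [hy]
  module

/-- `Lₙ` acts as a derivation on a product of two modes, by two uses of `sugawaraOp_zAct`. -/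
lemma sugawaraOp_quadAct (hlev : ρ.HasLevel k) (h : IsDualPair b t)
    (hc : ∀ X : C, k • copairingLeft t (g ⊗ X) ≫ g ◁ formLeft Quadratic.form X +
      (1 / 2 : ℂ) • casimirLeft t X = 𝟙 _) (n i j : ℤ) {X : C} (m : M.El X) :
    sugawaraOp hρ t n (ρ.quadAct t i j m) = ρ.quadAct t i j (sugawaraOp hρ t n m) -
      (i : ℂ) • ρ.quadAct t (n + i) j m - (j : ℂ) • ρ.quadAct t i (n + j) m := by
  simp only [quadAct, LinearMap.comp_apply, sugawaraOp_res, sugawaraOp_zAct hρ hlev h hc,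
    map_sub, map_smul]
  abel

lemma sugawaraOp_comm (hlev : ρ.HasLevel k) (h : IsDualPair b t)
    (hc : ∀ X : C, k • copairingLeft t (g ⊗ X) ≫ g ◁ formLeft Quadratic.form X +
      (1 / 2 : ℂ) • casimirLeft t X = 𝟙 _) {d : ℂ} (hd : t ≫ Quadratic.form = d • 𝟙 (𝟙_ C))
    (p n : ℤ) {X : C} (m : M.El X) :
    sugawaraOp hρ t p (sugawaraOp hρ t n m) = sugawaraOp hρ t n (sugawaraOp hρ t p m) +
      ((p : ℂ) - n) • sugawaraOp hρ t (p + n) m + (virCocycle p n * (k * d)) • m := by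
  set Q : ℤ → M.El X := fun j => ρ.quadAct t (n - j) j m with hQ
  set Q' : ℤ → M.El X := fun j => ρ.quadAct t (n - j) j (sugawaraOp hρ t p m) with hQ'
  set R : ℤ → M.El X := fun j => ρ.quadAct t (n + p - j) j m with hR
  have eQ : ∀ᶠ j in Filter.atTop, Q j = 0 := hρ.quadAct_eventually t (n - ·) m
  have eQ' : ∀ᶠ j in Filter.atTop, Q' j = 0 := hρ.quadAct_eventually t (n - ·) _
  have eR : ∀ᶠ j in Filter.atTop, R j = 0 := hρ.quadAct_eventually t (n + p - ·) m
  have eT : ∀ᶠ j : ℤ in Filter.atTop, (j : ℂ) • R j = 0 := eR.mono fun j hj => by simp [hj]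
  have shift {F : ℤ → M.El X} (hF : ∀ᶠ j in Filter.atTop, F j = 0) :
      ∀ᶠ j in Filter.atTop, F (j + p) = 0 :=
    (Filter.tendsto_atTop_add_const_right _ p Filter.tendsto_id).eventually hF
  have smul {F : ℤ → M.El X} (a : ℂ) (hF : ∀ᶠ j in Filter.atTop, F j = 0) :
      ∀ᶠ j in Filter.atTop, a • F j = 0 := hF.mono fun j hj => by simp [hj]
  have sub {F G : ℤ → M.El X} (hF : ∀ᶠ j in Filter.atTop, F j = 0)
      (hG : ∀ᶠ j in Filter.atTop, G j = 0) : ∀ᶠ j in Filter.atTop, F j - G j = 0 := by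
    filter_upwards [hF, hG] with j h₁ h₂
    rw [h₁, h₂, sub_zero]
  -- The derivation rule gives `(j - n) R j - j R (j + p)`; writing `j = (j + p) - p` makes the
  -- second part a shift of `(j - p) R j`. Splitting off `(p - n) R j` then accounts for the term in
  -- `L_{p+n}` and leaves only windows.
  have pointwise (j : ℤ) : sugawaraOp hρ t p (Q j) =
      Q' j + ((((j : ℂ) • R j - (n : ℂ) • R j)) -
        (((j + p : ℤ) : ℂ) • R (j + p) - (p : ℂ) • R (j + p))) := by
    have e₁ : n + p - (j + p) = n - j := by ring
    have e₂ : p + (n - j) = n + p - j := by ring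
    simp only [hQ, hQ', hR]
    rw [sugawaraOp_quadAct hρ hlev h hc, e₁, e₂, add_comm p j]
    push_cast
    module
  have sum (q : ℤ) : sugawaraOp hρ t p (tailSum Q q) = tailSum Q' q +
      ((tailSum (fun j => (j : ℂ) • R j) q - (n : ℂ) • tailSum R q) -
        (tailSum (fun j => (j : ℂ) • R j) (q + p) - (p : ℂ) • tailSum R (q + p))) := by
    rw [map_tailSum _ eQ]
    simp only [pointwise]
    rw [tailSum_add eQ' (sub (sub eT (smul _ eR)) (sub (shift eT) (smul _ (shift eR)))),
      tailSum_sub (sub eT (smul _ eR)) (sub (shift eT) (smul _ (shift eR))),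
      tailSum_sub eT (smul _ eR), tailSum_sub (shift eT) (smul _ (shift eR)),
      tailSum_smul _ eR, tailSum_smul _ (shift eR), tailSum_shift R,
      tailSum_shift (fun j => (j : ℂ) • R j)]
  -- Reflection exchanges the two modes of `R j`; they fail to commute only in total degree zero.
  have anti (j : ℤ) : R (n + p - j) - R j =
      (j : ℂ) • (if p + n = 0 then (k * d) • m else 0) := by
    simp only [hR, sub_sub_cancel]
    rw [hlev.quadAct_swap h hd j (n + p - j), add_sub_cancel_left, affCocycle,
      show j + (n + p - j) = p + n by ring]
    split_ifs <;> module
  have S := tailSum_cubic eR anti p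
  rw [show n + p - p + 1 = n + 1 by ring] at S
  have V : (virCocycle p n * (k * d)) • m =
      ((1 / 2 : ℂ) * (((p : ℂ) ^ 3 - p) / 6)) • (if p + n = 0 then (k * d) • m else 0) := by
    unfold virCocycle
    split_ifs <;> module
  rw [V]
  generalize (if p + n = 0 then (k * d) • m else 0) = κ at S ⊢
  rw [sugawaraOp_apply hρ t n m, map_smul, map_add, sum, sum, sugawaraOp_apply hρ t n,
    sugawaraOp_apply hρ t (p + n), show n + 1 + p = n + p + 1 by ring, zero_add, add_comm p n]
  linear_combination (norm := skip) (1 / 2 : ℂ) • S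
  push_cast
  module

/-- Compares the ordering by `min` and `max` with the ordering by the sign of `i`. For `n ≠ 0` the
modes commute after contraction with `B_k⁻¹`, so the order is immaterial; for `n = 0` the two
prescriptions coincide. -/
lemma sugawaraAct_eq (hlev : ρ.HasLevel k) (hk : IsNonCritical g k) {d : ℂ}
    (hd : copairing (levelForm g k) hk ≫ Quadratic.form = d • 𝟙 (𝟙_ C)) (n i : ℤ) {X : C}
    (m : M.El X) : ρ.sugawaraAct hk i (n - i) m =
      (if 0 ≤ i then ρ.quadAct (copairing (levelForm g k) hk) (n - i) i m else 0) +
      (if i < 0 then ρ.quadAct (copairing (levelForm g k) hk) (n - (n - i)) (n - i) m else 0) := by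
  have swap (i j : ℤ) (hij : i + j ≠ 0) :
      ρ.quadAct (copairing (levelForm g k) hk) i j m =
        ρ.quadAct (copairing (levelForm g k) hk) j i m := by
    rw [hlev.quadAct_swap (isDualPair_levelForm hk) hd i j, affCocycle, if_neg hij]
    simp
  rw [sugawaraAct, sub_sub_cancel]
  rcases le_total i (n - i) with h | h
  · rw [min_eq_left h, max_eq_right h]
    by_cases h₀ : 0 ≤ i
    · rw [if_pos h₀, if_neg (by omega), add_zero]
      by_cases hn : n = 0
      · obtain rfl : i = 0 := by omega
        subst hn; rfl
      · exact swap _ _ (by omega)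
    · rw [if_neg h₀, if_pos (by omega), zero_add]
  · rw [min_eq_right h, max_eq_left h]
    by_cases h₀ : 0 ≤ i
    · rw [if_pos h₀, if_neg (by omega), add_zero]
    · rw [if_neg h₀, if_pos (by omega), zero_add]
      exact swap _ _ (by omega)

lemma sugawaraOp_eq_finsum (hlev : ρ.HasLevel k) (hk : IsNonCritical g k) {d : ℂ}
    (hd : copairing (levelForm g k) hk ≫ Quadratic.form = d • 𝟙 (𝟙_ C)) (n : ℤ) {X : C}
    (m : M.El X) :
    (Function.support fun i : ℤ => ρ.sugawaraAct hk i (n - i) m).Finite ∧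
      sugawaraOp hρ (copairing (levelForm g k) hk) n m =
        (1 / 2 : ℂ) • ∑ᶠ i : ℤ, ρ.sugawaraAct hk i (n - i) m := by
  have e := hρ.quadAct_eventually (copairing (levelForm g k) hk) (n - ·) m
  have f₁ := tailSum_support_finite e 0
  have f₂ : (Function.support fun i : ℤ => if i < 0 then
      ρ.quadAct (copairing (levelForm g k) hk) (n - (n - i)) (n - i) m else 0).Finite := by
    refine ((tailSum_support_finite e (n + 1)).preimage
      (sub_right_injective (b := n)).injOn).subset fun i hi => ?_
    rw [Function.mem_support, ne_eq, ite_eq_right_iff, Classical.not_imp] at hi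
    rw [Set.mem_preimage, Function.mem_support, if_pos (by omega)]
    exact hi.2
  simp only [sugawaraAct_eq hlev hk hd]
  refine ⟨(f₁.union f₂).subset (Function.support_add _ _), ?_⟩
  -- The substitution `j = n - i` carries the half `i < 0` to the tail starting at `n + 1`.
  rw [finsum_add_distrib f₁ f₂, tailSum_reflect
    (fun j => ρ.quadAct (copairing (levelForm g k) hk) (n - j) j m) n 0, sugawaraOp_apply,
    sub_zero, add_comm]
  rfl

end LieMod

end SugawaraOperators

/-! ### Modules over a coproduct from operators on its summands -/

section ActionComponents

variable {C : Type u} [Category.{v} C] [Abelian C] [Linear ℂ C] [MonoidalCategory C]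
  [SymmetricCategory C] [MonoidalPreadditive C] [MonoidalLinear ℂ C]

/-- The morphism `(∐ i, Y i) ⊗ M ⟶ P` given by natural families of operators
`Hom(X, M) → Hom(Y i ⊗ X, P)`. -/
def Bilin.ofOperators {ι : Type} (Y : ι → C) {M P : IndObj C}
    (φ : ∀ (i : ι) {X : C}, M.El X →ₗ[ℂ] P.El (Y i ⊗ X))
    (nat : ∀ (i : ι) {X X' : C} (f : X ⟶ X') (m : M.El X'),
      φ i (M.res f m) = P.res (Y i ◁ f) (φ i m)) : Bilin (coprod Y) M P where
  app {X X'} := coprodDesc Y fun i =>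
    { toFun := fun f => P.res (f ▷ X') ∘ₗ φ i
      map_add' := fun f f' => by
        ext m
        simp [MonoidalPreadditive.add_whiskerRight, IndObj.add_res]
      map_smul' := fun a f => by
        ext m
        simp [MonoidalLinear.smul_whiskerRight, IndObj.smul_res] }
  naturality f g m n := by
    induction m using coprod_induction with
    | zero => simp
    | add x y hx hy => simp only [map_add, LinearMap.add_apply, hx, hy]
    | of i f' =>
      simp only [res_coprodι, coprodDesc_ι, LinearMap.coe_mk, AddHom.coe_mk,
        LinearMap.comp_apply, nat, IndObj.res_res]
      simp [MonoidalCategory.tensorHom_def, whisker_exchange]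

@[simp] lemma Bilin.ofOperators_app {ι : Type} (Y : ι → C) {M P : IndObj C}
    (φ : ∀ (i : ι) {X : C}, M.El X →ₗ[ℂ] P.El (Y i ⊗ X))
    (nat : ∀ (i : ι) {X X' : C} (f : X ⟶ X') (m : M.El X'),
      φ i (M.res f m) = P.res (Y i ◁ f) (φ i m)) (i : ι) {X X' : C} (f : X ⟶ Y i)
    (m : M.El X') : (ofOperators Y φ nat).app (coprodι Y i f) m = P.res (f ▷ X') (φ i m) := by
  simp [ofOperators]

/-- By additivity both arguments lie in single summands, hence are restrictions of the universal
elements `𝟙 (Y i)`; the relation is pulled back from there by naturality. -/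
lemma Bilin.ofOperators_lie {ι : Type} (Y : ι → C) (p : ∀ i j, (coprod Y).El (Y i ⊗ Y j))
    {M : IndObj C} (φ : ∀ (i : ι) {X : C}, M.El X →ₗ[ℂ] M.El (Y i ⊗ X))
    (nat : ∀ (i : ι) {X X' : C} (f : X ⟶ X') (m : M.El X'),
      φ i (M.res f m) = M.res (Y i ◁ f) (φ i m))
    (lie : ∀ (i j : ι) {X : C} (m : M.El X),
      M.res (α_ (Y i) (Y j) X).inv ((ofOperators Y φ nat).app (p i j) m) =
        φ i (φ j m) - M.res (swapLeft (Y i) (Y j) X) (φ j (φ i m)))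
    {X X' X'' : C} (a : (coprod Y).El X) (b : (coprod Y).El X') (m : M.El X'') :
    M.res (α_ X X' X'').inv ((ofOperators Y φ nat).app ((ofComponents Y Y _ p).app a b) m) =
      (ofOperators Y φ nat).app a ((ofOperators Y φ nat).app b m) -
        M.res (swapLeft X X' X'')
          ((ofOperators Y φ nat).app b ((ofOperators Y φ nat).app a m)) := by
  induction a using coprod_induction with
  | zero => simp
  | add x y hx hy =>
    simp only [map_add, LinearMap.add_apply, hx, hy]; abel
  | of i f =>
    induction b using coprod_induction with
    | zero => simp
    | add x y hx hy => simp only [map_add, LinearMap.add_apply, hx, hy]; abel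
    | of j f' =>
      have H := congrArg (M.res (f ⊗ₘ (f' ⊗ₘ 𝟙 X''))) (lie i j m)
      rw [map_sub] at H
      simp only [IndObj.res_res, swapLeft_naturality, associator_inv_naturality] at H
      simp only [Bilin.ofComponents_app, Bilin.res_left, Bilin.ofOperators_app, nat,
        IndObj.res_res]
      simpa [MonoidalCategory.tensorHom_def] using H

/-- The module over `∐ i, Y i` given by natural families of operators satisfying the commutation
relations. -/
def LieMod.ofOperators {ι : Type} (Y : ι → C) (p : ∀ i j, (coprod Y).El (Y i ⊗ Y j))
    (skew : ∀ i j, p i j = - (coprod Y).res (β_ (Y i) (Y j)).hom (p j i))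
    (jacobi : ∀ i j k, Jacobi (Bilin.ofComponents Y Y _ p)
      (coprodι Y i (𝟙 (Y i))) (coprodι Y j (𝟙 (Y j))) (coprodι Y k (𝟙 (Y k)))) {M : IndObj C}
    (φ : ∀ (i : ι) {X : C}, M.El X →ₗ[ℂ] M.El (Y i ⊗ X))
    (nat : ∀ (i : ι) {X X' : C} (f : X ⟶ X') (m : M.El X'),
      φ i (M.res f m) = M.res (Y i ◁ f) (φ i m))
    (lie : ∀ (i j : ι) {X : C} (m : M.El X),
      M.res (α_ (Y i) (Y j) X).inv ((Bilin.ofOperators Y φ nat).app (p i j) m) =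
        φ i (φ j m) - M.res (swapLeft (Y i) (Y j) X) (φ j (φ i m))) :
    LieMod (LieAlg.ofComponents Y p skew jacobi) M where
  act := Bilin.ofOperators Y φ nat
  lie := Bilin.ofOperators_lie Y p φ nat lie

end ActionComponents

/-! ### The action of `Vir ⋉ ĝ` and the theorem -/

section Main

variable {C : Type u} [Category.{v} C] [Abelian C] [Linear ℂ C] [MonoidalCategory C]
  [SymmetricCategory C] [RigidCategory C] [MonoidalPreadditive C] [MonoidalLinear ℂ C]
  {g : C} [LieObj g] [Quadratic g] {M : IndObj C}

namespace LieMod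

variable {ρ : LieMod (affine g) M} (hρ : ρ.IsSmooth) (t : 𝟙_ C ⟶ g ⊗ g) (k c : ℂ)

/-- The action of the summands of `Vir ⋉ ĝ` given by the Sugawara construction at level `k` and
central charge `c`. -/
def virAffOp : ∀ (i : VirAffIdx) {X : C}, M.El X →ₗ[ℂ] M.El (virAffObj g i ⊗ X)
  | .L n, X => M.res (λ_ X).hom ∘ₗ sugawaraOp hρ t n
  | .c, X => c • M.res (λ_ X).hom
  | .z n, _ => ρ.zAct n
  | .K, X => k • M.res (λ_ X).hom

lemma virAffOp_res (i : VirAffIdx) {X X' : C} (f : X ⟶ X') (m : M.El X') :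
    virAffOp hρ t k c i (M.res f m) = M.res (virAffObj g i ◁ f) (virAffOp hρ t k c i m) := by
  have h := leftUnitor_naturality f
  cases i with
  | L n =>
    change M.res (λ_ X).hom (sugawaraOp hρ t n (M.res f m)) =
      M.res (𝟙_ C ◁ f) (M.res (λ_ X').hom (sugawaraOp hρ t n m))
    rw [sugawaraOp_res, IndObj.res_res, IndObj.res_res, h]
  | c =>
    change c • M.res (λ_ X).hom (M.res f m) = M.res (𝟙_ C ◁ f) (c • M.res (λ_ X').hom m)
    rw [map_smul, IndObj.res_res, IndObj.res_res, h]
  | z n => exact ρ.zAct_res n f m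
  | K =>
    change k • M.res (λ_ X).hom (M.res f m) = M.res (𝟙_ C ◁ f) (k • M.res (λ_ X').hom m)
    rw [map_smul, IndObj.res_res, IndObj.res_res, h]

/-- The action of `Vir ⋉ ĝ` given by the Sugawara construction, as a bilinear operation. -/
def virAffAct : Bilin (coprod (virAffObj g)) M M :=
  Bilin.ofOperators (virAffObj g) (virAffOp hρ t k c) (virAffOp_res hρ t k c)

lemma virAffAct_L (n : ℤ) {X Y : C} (f : Y ⟶ 𝟙_ C) (m : M.El X) :
    (virAffAct hρ t k c).app (virAffL g n f) m =
      M.res (f ▷ X ≫ (λ_ X).hom) (sugawaraOp hρ t n m) := by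
  rw [← IndObj.res_res]
  exact Bilin.ofOperators_app ..

lemma virAffAct_C {X Y : C} (f : Y ⟶ 𝟙_ C) (m : M.El X) :
    (virAffAct hρ t k c).app (virAffC g f) m = c • M.res (f ▷ X ≫ (λ_ X).hom) m := by
  rw [← IndObj.res_res, ← map_smul]
  exact Bilin.ofOperators_app ..

lemma virAffAct_Z (n : ℤ) {X Y : C} (f : Y ⟶ g) (m : M.El X) :
    (virAffAct hρ t k c).app (virAffZ g n f) m = M.res (f ▷ X) (ρ.zAct n m) :=
  Bilin.ofOperators_app ..

lemma virAffAct_K {X Y : C} (f : Y ⟶ 𝟙_ C) (m : M.El X) :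
    (virAffAct hρ t k c).app (virAffK g f) m = k • M.res (f ▷ X ≫ (λ_ X).hom) m := by
  rw [← IndObj.res_res, ← map_smul]
  exact Bilin.ofOperators_app ..

/-- A scalar action of `𝟙` commutes with every natural operator. This settles all brackets with `c`
and `K`. -/
lemma scalar_comm (a : ℂ) {Y : C} (φ : ∀ {X : C}, M.El X →ₗ[ℂ] M.El (Y ⊗ X))
    (hφ : ∀ {X X' : C} (f : X ⟶ X') (m : M.El X'), φ (M.res f m) = M.res (Y ◁ f) (φ m))
    {X : C} (m : M.El X) :
    a • M.res (λ_ (Y ⊗ X)).hom (φ m) =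
        M.res (swapLeft (𝟙_ C) Y X) (φ (a • M.res (λ_ X).hom m)) ∧
      φ (a • M.res (λ_ X).hom m) =
        M.res (swapLeft Y (𝟙_ C) X) (a • M.res (λ_ (Y ⊗ X)).hom (φ m)) := by
  simp only [map_smul, hφ, IndObj.res_res, swapLeft_unit₁, swapLeft_unit₂, and_self]

variable {t k} {b : g ⊗ g ⟶ 𝟙_ C}

lemma virAffOp_lie (hlev : ρ.HasLevel k) (h : IsDualPair b t)
    (hc : ∀ X : C, k • copairingLeft t (g ⊗ X) ≫ g ◁ formLeft Quadratic.form X +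
      (1 / 2 : ℂ) • casimirLeft t X = 𝟙 _) {d : ℂ} (hd : t ≫ Quadratic.form = d • 𝟙 (𝟙_ C))
    (i j : VirAffIdx) {X : C} (m : M.El X) :
    M.res (α_ (virAffObj g i) (virAffObj g j) X).inv
        ((virAffAct hρ t k (k * d)).app (virAffBracket g i j) m) =
      virAffOp hρ t k (k * d) i (virAffOp hρ t k (k * d) j m) -
        M.res (swapLeft (virAffObj g i) (virAffObj g j) X)
          (virAffOp hρ t k (k * d) j (virAffOp hρ t k (k * d) i m)) := by
  have central {i j : VirAffIdx} (h₀ : virAffBracket g i j = 0)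
      (h₁ : virAffOp hρ t k (k * d) i (virAffOp hρ t k (k * d) j m) =
        M.res (swapLeft (virAffObj g i) (virAffObj g j) X)
          (virAffOp hρ t k (k * d) j (virAffOp hρ t k (k * d) i m))) :
      M.res (α_ (virAffObj g i) (virAffObj g j) X).inv
          ((virAffAct hρ t k (k * d)).app (virAffBracket g i j) m) =
        virAffOp hρ t k (k * d) i (virAffOp hρ t k (k * d) j m) -
          M.res (swapLeft (virAffObj g i) (virAffObj g j) X)
            (virAffOp hρ t k (k * d) j (virAffOp hρ t k (k * d) i m)) := by
    rw [h₀, h₁, map_zero, LinearMap.zero_apply, map_zero, sub_self]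
  have comm (a : ℂ) (i : VirAffIdx) := scalar_comm a (virAffOp hρ t k (k * d) i)
    (virAffOp_res hρ t k (k * d) i) m
  have LL (p n : ℤ) : M.res (α_ (𝟙_ C) (𝟙_ C) X).inv ((virAffAct hρ t k (k * d)).app
        (virAffL g (p + n) (((p : ℂ) - n) • (λ_ (𝟙_ C)).hom) +
          virAffC g (virCocycle p n • (λ_ (𝟙_ C)).hom)) m) =
      M.res (λ_ (𝟙_ C ⊗ X)).hom (sugawaraOp hρ t p (M.res (λ_ X).hom (sugawaraOp hρ t n m))) -
        M.res (swapLeft (𝟙_ C) (𝟙_ C) X) (M.res (λ_ (𝟙_ C ⊗ X)).hom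
          (sugawaraOp hρ t n (M.res (λ_ X).hom (sugawaraOp hρ t p m)))) := by
    simp only [map_add, LinearMap.add_apply, map_smul, LinearMap.smul_apply, virAffAct_L,
      virAffAct_C, sugawaraOp_res, IndObj.res_res, reassoc_of% swapLeft_unit₂,
      reassoc_of% assoc_unit₁, leftUnitor_naturality, sugawaraOp_comm hρ hlev h hc hd p n]
    module
  have Lz (n p : ℤ) : M.res (α_ (𝟙_ C) g X).inv ((virAffAct hρ t k (k * d)).app
        (virAffZ g (p + n) ((-p : ℂ) • (λ_ g).hom)) m) =
      M.res (λ_ (g ⊗ X)).hom (sugawaraOp hρ t n (ρ.zAct p m)) -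
        M.res (swapLeft (𝟙_ C) g X) (ρ.zAct p (M.res (λ_ X).hom (sugawaraOp hρ t n m))) := by
    simp only [map_smul, LinearMap.smul_apply, virAffAct_Z, zAct_res, IndObj.res_res,
      swapLeft_unit₁, assoc_unit₁, sugawaraOp_zAct hρ hlev h hc, map_sub, add_comm p n]
    module
  have zL (p n : ℤ) : M.res (α_ g (𝟙_ C) X).inv ((virAffAct hρ t k (k * d)).app
        (virAffZ g (p + n) ((p : ℂ) • (ρ_ g).hom)) m) =
      ρ.zAct p (M.res (λ_ X).hom (sugawaraOp hρ t n m)) -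
        M.res (swapLeft g (𝟙_ C) X) (M.res (λ_ (g ⊗ X)).hom (sugawaraOp hρ t n (ρ.zAct p m))) := by
    simp only [map_smul, LinearMap.smul_apply, virAffAct_Z, zAct_res, IndObj.res_res,
      swapLeft_unit₂, assoc_unit₂, sugawaraOp_zAct hρ hlev h hc, map_sub, add_comm p n]
    module
  have zz (p n : ℤ) : M.res (α_ g g X).inv ((virAffAct hρ t k (k * d)).app
        (virAffZ g (p + n) (LieObj.bracket (g := g)) +
          virAffK g (affCocycle p n • Quadratic.form (g := g))) m) =
      ρ.zAct p (ρ.zAct n m) - M.res (swapLeft g g X) (ρ.zAct n (ρ.zAct p m)) := by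
    simp only [map_add, LinearMap.add_apply, map_smul, LinearMap.smul_apply, virAffAct_Z,
      virAffAct_K, IndObj.res_res, hlev.zAct_zAct p n, bracketLeft, formLeft]
    module
  cases i with
  | c => exact central (by cases j <;> rfl) (comm (k * d) j).1
  | K => exact central (by cases j <;> rfl) (comm k j).1
  | L p =>
    cases j with
    | c => exact central rfl (comm (k * d) (.L p)).2
    | K => exact central rfl (comm k (.L p)).2
    | L n => exact LL p n
    | z n => exact Lz p n
  | z p =>
    cases j with
    | c => exact central rfl (comm (k * d) (.z p)).2
    | K => exact central rfl (comm k (.z p)).2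
    | L n => exact zL p n
    | z n => exact zz p n

/-- The action of `Vir ⋉ ĝ` given by the Sugawara construction. -/
def sugawara (hlev : ρ.HasLevel k) (h : IsDualPair b t)
    (hc : ∀ X : C, k • copairingLeft t (g ⊗ X) ≫ g ◁ formLeft Quadratic.form X +
      (1 / 2 : ℂ) • casimirLeft t X = 𝟙 _) {d : ℂ} (hd : t ≫ Quadratic.form = d • 𝟙 (𝟙_ C)) :
    LieMod (virAffine g) M :=
  LieMod.ofOperators (virAffObj g) (virAffBracket g) (virAffBracket_skew g)
    (virAffBilin_jacobi g) (virAffOp hρ t k (k * d)) (virAffOp_res hρ t k (k * d))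
    fun i j _ m => virAffOp_lie hρ hlev h hc hd i j m

lemma virAffAct_affIncl (hlev : ρ.HasLevel k) {X Y : C} (a : (coprod (affObj g)).El X)
    (m : M.El Y) : (virAffAct hρ t k c).app (affIncl g a) m = ρ.affAct.app a m := by
  induction a using coprod_induction with
  | zero =>
    have : affIncl g (0 : (coprod (affObj g)).El X) = 0 := map_zero _
    rw [this, map_zero]
    exact congrArg (· m) (map_zero ((virAffAct hρ t k c).app (X := X) (Y := Y)))
  | add x y hx hy =>
    rw [map_add, LinearMap.add_apply, ← hx, ← hy]
    have : affIncl g (x + y : (coprod (affObj g)).El X) = affIncl g x + affIncl g y :=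
      map_add _ x y
    rw [this]
    exact congrArg (· m) (map_add ((virAffAct hρ t k c).app (X := X) (Y := Y)) (affIncl g x) (affIncl g y))
  | of i f =>
    cases i with
    | z n =>
      have e : affIncl g (affZ g n f) = virAffZ g n f := coprodDesc_ι ..
      exact (congrArg (fun a => (virAffAct hρ t k c).app a m) e).trans
        ((virAffAct_Z hρ t k c n f m).trans (ρ.affAct_affZ n f m).symm)
    | K =>
      have e : affIncl g (affK g f) = virAffK g f := coprodDesc_ι ..
      exact (congrArg (fun a => (virAffAct hρ t k c).app a m) e).trans
        ((virAffAct_K hρ t k c f m).trans (hlev.affAct_affK f m).symm)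

end LieMod

end Main

end SymTensor

end


theorem mainTheorem9 {C : Type u} [Category.{v} C] [Abelian C] [Linear ℂ C] [MonoidalCategory C]
    [MonoidalPreadditive C] [MonoidalLinear ℂ C] [SymmetricCategory C] [RigidCategory C]
    [IsSymmetricTensorCategory C] (g : C) [LieObj g] [Quadratic g] (k : ℂ)
    (hk : IsNonCritical g k) (M : IndObj C) (ρ : LieMod (affine g) M) (hadm : ρ.IsAdmissible)
    (hlev : ρ.HasLevel k) :
    ∃ σ : LieMod (virAffine g) M,
      σ.Extends ρ ∧
      (∀ (n : ℤ) (X : C) (m : M.El X),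
        (Function.support fun i : ℤ => ρ.sugawaraAct hk i (n - i) m).Finite ∧
        σ.L n m = (1 / 2 : ℂ) • ∑ᶠ i : ℤ, ρ.sugawaraAct hk i (n - i) m) ∧
      ∃ c : ℂ, c • 𝟙 (𝟙_ C) = k • (copairing (levelForm g k) hk ≫ Quadratic.form) ∧
        σ.HasCentralCharge c := by
  have hρ : ρ.IsSmooth := fun {X} m =>
    have := IsSymmetricTensorCategory.noetherian X
    hadm.eventually_zAct_eq_zero m
  -- `End(𝟙) = ℂ` turns `B ∘ B_k⁻¹` into a scalar `d`; the central charge is `k * d`.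
  obtain ⟨d, hd⟩ := IsSymmetricTensorCategory.end_unit.2
    (copairing (levelForm g k) hk ≫ Quadratic.form (g := g))
  have hd' : copairing (levelForm g k) hk ≫ Quadratic.form = d • 𝟙 (𝟙_ C) := hd.symm
  refine ⟨LieMod.sugawara hρ hlev (isDualPair_levelForm hk) (copairing_form_add_casimir hk) hd',
    fun X Y a m => LieMod.virAffAct_affIncl hρ (k * d) hlev a m, fun n X m => ?_, k * d, ?_,
    fun X m => ?_⟩
  · have H := LieMod.sugawaraOp_eq_finsum hρ hlev hk hd' n m
    refine ⟨H.1, Eq.trans ?_ H.2⟩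
    change M.res (λ_ X).inv ((LieMod.virAffAct hρ _ k (k * d)).app (virAffL g n (𝟙 (𝟙_ C))) m) = _
    rw [LieMod.virAffAct_L, IndObj.res_res]
    simp
  · rw [hd', mul_smul]
  · refine (LieMod.virAffAct_C hρ _ k (k * d) (𝟙 (𝟙_ C)) m).trans ?_
    rw [id_whiskerRight, Category.id_comp]
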